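/- \textbf{Setting.} Let $\theta=(\theta_0,\theta_0,\theta_0)'\in\mathbb R^3$, $\Gamma=I$ and $$R=\begin{pmatrix}1&r_2&r_1\\ r_1&1&r_2\\ r_2&r_1&1\end{pmatrix}.$$ An $R$-regulation of a continuous path $x:[0,\infty)\to\mathbb R^3$ is a pair $(z,y)$ of continuous paths $[0,\infty)\to\mathbb R^3$ such that $z(t)=x(t)+Ry(t)\ge 0$ for all $t\ge 0$, each $y_i$ is non-decreasing, $y(0)=0$, and $\int_0^\infty z_i(s)\,dy_i(s)=0$ for $i=1,2,3$. Let $\mathcal H$ be the set of absolutely continuous paths $x:[0,\infty)\to\mathbb R^3$ with $x(0)=0$ whose derivative is square integrable on bounded intervals. For $v\in\mathbb R^3_+=\{v\in\mathbb R^3: v_i\ge 0 \text{ for } i=1,2,3\}$ let $$I(v)=\inf \tfrac12\int_0^T\|\dot x(t)-\theta\|^2\,dt ,$$ the infimum being over all $T\ge 0$, $x\in\mathcal H$ and $R$-regulations $(z,y)$ of $x$ with $z(T)=v$ (here $\|\cdot\|$ is the Euclidean norm, since $\Gamma=I$). If $x\in\mathcal H$, $(z,y)$ is an $R$-regulation of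 $x$, $z(T)=v$ and $\frac12\int_0^T\|\dot x-\theta\|^2dt=I(v)$, then $z$ (considered on $[0,T]$) is called an \emph{optimal path} to $v$ with optimal time $T$. It has \emph{finitely many pieces} if there are $n\ge 0$ and $0=\tau_0<\tau_1<\dots<\tau_n=T$ such that $z$ is affine on each $[\tau_{i-1},\tau_i]$. For $K\subset\{1,2,3\}$ let $F_K=\{v\in\mathbb R^3_+: v_i=0 \text{ for } i\in K\}$, a face of dimension $3-|K|$, with relative interior $\{v\in F_K: v_i>0\text{ for } i\notin K\}$. A path $z$ on $[0,T]$ is \emph{gradual} if it has finitely many pieces, for suitable $\tau_0<\dots<\tau_n$ as above, and there are faces $F_{K_1},\dots,F_{K_n}$ of strictly increasing positive dimensions such that, for each $i$, $z([\tau_{i-1},\tau_i])\subset F_{K_i}$ and $z(\tau_i)$ lies in the relative interior of $F_{K_i}$. \textbf{Theorem.} Suppose $\theta_0<0$, $r_1,r_2\ge 0$, $r_1>r_2$, $-1<r_1+r_2<2$, and $$(1+r_2^2)(1+r_1^2-r_2-r_1r_2)^2\ \ge\ 2(r_1r_2)^2(1+r_1^2+r_2^2-r_1-r_2-r_1r_2).$$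 Let $v\in\mathbb R^3_+$. If there is an optimal path to $v$ with finitely many pieces, then there is a gradual optimal path to $v$. -/

import Mathlib

open Set MeasureTheory
open scoped Matrix

noncomputable section

/-! ### Paths, the Skorohod problem and the variational problem -/

/-- A path `[0, ∞) → ℝ^d` is represented by a function on `ℝ`; only its values at times `t ≥ 0`
are ever used. -/
abbrev OrthantPath (d : ℕ) := ℝ → Fin d → ℝ

/-- A continuous non-decreasing function on `[0, ∞)` as a Stieltjes function on `ℝ`
(extended to negative times by its value at `0`, so that the associated measure
does not charge negative times). -/
def stieltjesOfPath (f : ℝ → ℝ) (hm : MonotoneOn f (Ici 0)) (hc : ContinuousOn f (Ici 0)) :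
    StieltjesFunction ℝ where
  toFun t := f (max t 0)
  mono' := fun s t h => hm (show (0 : ℝ) ≤ max s 0 from le_max_right s 0)
    (show (0 : ℝ) ≤ max t 0 from le_max_right t 0) (max_le_max_right 0 h)
  right_continuous' := fun _ =>
    (hc.comp_continuous (continuous_id.max continuous_const)
      (fun s => (le_max_right s 0 : (0 : ℝ) ≤ max s 0))).continuousAt.continuousWithinAt

/-- `(z, y)` is an `R`-regulation of the path `x`, that is, a solution of the Skorohod problem. -/
structure IsRegulation {d : ℕ} (R : Matrix (Fin d) (Fin d) ℝ) (x y z : OrthantPath d) : Prop where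
  x_cont : ContinuousOn x (Ici 0)
  y_cont : ∀ i, ContinuousOn (fun t => y t i) (Ici 0)
  z_cont : ContinuousOn z (Ici 0)
  eq : ∀ t, 0 ≤ t → z t = x t + R *ᵥ y t
  z_nonneg : ∀ t, 0 ≤ t → ∀ i, 0 ≤ z t i
  y_mono : ∀ i, MonotoneOn (fun t => y t i) (Ici 0)
  y_zero : y 0 = 0
  /-- `∫₀^∞ z_i dy_i = 0` (Lebesgue–Stieltjes integral). -/
  compl : ∀ i, ∫⁻ t in Ici 0, ENNReal.ofReal (z t i)
    ∂(stieltjesOfPath (fun t => y t i) (y_mono i) (y_cont i)).measure = 0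

/-- The space `ℋ^d` of absolutely continuous paths started at `0` whose derivative is square
integrable on bounded intervals. -/
structure MemH {d : ℕ} (x : OrthantPath d) : Prop where
  absCont : ∀ T, 0 ≤ T → AbsolutelyContinuousOnInterval x 0 T
  sqIntegrable : ∀ T, 0 ≤ T → ∀ i, IntervalIntegrable (fun t => (deriv x t i) ^ 2) volume 0 T
  zero : x 0 = 0

/-- The squared norm `‖w‖² = w' Γ⁻¹ w`. -/
def gammaNormSq {d : ℕ} (Γ : Matrix (Fin d) (Fin d) ℝ) (w : Fin d → ℝ) : ℝ :=
  w ⬝ᵥ (Γ⁻¹ *ᵥ w)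

/-- The cost `½ ∫₀^T ‖ẋ(t) - θ‖² dt`. -/
def pathCost {d : ℕ} (θ : Fin d → ℝ) (Γ : Matrix (Fin d) (Fin d) ℝ) (x : OrthantPath d) (T : ℝ) : ℝ :=
  (1 / 2) * ∫ t in (0 : ℝ)..T, gammaNormSq Γ (deriv x t - θ)

/-- `(x, y, z)` is a feasible triple which reaches `v` at time `T`. -/
def IsFeasible {d : ℕ} (R : Matrix (Fin d) (Fin d) ℝ) (v : Fin d → ℝ) (x y z : OrthantPath d) (T : ℝ) :
    Prop :=
  0 ≤ T ∧ MemH x ∧ IsRegulation R x y z ∧ z T = v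

/-- The optimal value `I(v)`. For `v ≥ 0` the set of costs is nonempty (straight paths are
feasible), and for positive definite `Γ` it is bounded below by `0`. -/
def vpValue {d : ℕ} (θ : Fin d → ℝ) (Γ R : Matrix (Fin d) (Fin d) ℝ) (v : Fin d → ℝ) : ℝ :=
  sInf {c | ∃ x y z T, IsFeasible R v x y z T ∧ c = pathCost θ Γ x T}

/-- `(x, y, z)` is an optimal triple for `v` with optimal time `T`; then `z` is an optimal path. -/
def IsOptimalTriple {d : ℕ} (θ : Fin d → ℝ) (Γ R : Matrix (Fin d) (Fin d) ℝ) (v : Fin d → ℝ)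
    (x y z : OrthantPath d) (T : ℝ) : Prop :=
  IsFeasible R v x y z T ∧ pathCost θ Γ x T = vpValue θ Γ R v

/-! ### Finitely many pieces, and gradual paths -/

/-- The face `F_K` of the orthant. -/
def face {d : ℕ} (K : Finset (Fin d)) : Set (Fin d → ℝ) :=
  {v | (∀ i, 0 ≤ v i) ∧ ∀ i ∈ K, v i = 0}

/-- The relative interior of the face `F_K`. -/
def faceInterior {d : ℕ} (K : Finset (Fin d)) : Set (Fin d → ℝ) :=
  {v | (∀ i ∈ K, v i = 0) ∧ ∀ i ∉ K, 0 < v i}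

/-- The dimension of the face `F_K` (here `K.card ≤ d` always). -/
def faceDim {d : ℕ} (K : Finset (Fin d)) : ℕ := d - K.card

/-- On `[0, T]` the path `z` consists of the `n` linear pieces with breakpoints
`0 = τ 0 < τ 1 < ⋯ < τ n = T`. -/
def HasPieces {d : ℕ} (z : OrthantPath d) (T : ℝ) (n : ℕ) (τ : Fin (n + 1) → ℝ) : Prop :=
  StrictMono τ ∧ τ 0 = 0 ∧ τ (Fin.last n) = T ∧
    ∀ i : Fin n, ∃ a b : Fin d → ℝ, ∀ t ∈ Icc (τ i.castSucc) (τ i.succ), z t = a + t • b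

/-- On `[0, T]` the path `z` has finitely many (linear) pieces. -/
def HasFinitelyManyPieces {d : ℕ} (z : OrthantPath d) (T : ℝ) : Prop :=
  ∃ n τ, HasPieces z T n τ

/-- On `[0, T]` the path `z` is gradual: it has finitely many pieces, the `i`-th piece lies in a
face `F_{K i}` and ends in the relative interior of that face, and the dimensions of these faces
are positive and strictly increasing. -/
def IsGradual {d : ℕ} (z : OrthantPath d) (T : ℝ) : Prop :=
  ∃ n τ, HasPieces z T n τ ∧ ∃ K : Fin n → Finset (Fin d),
    (∀ i, ∀ t ∈ Icc (τ i.castSucc) (τ i.succ), z t ∈ face (K i)) ∧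
    (∀ i, z (τ i.succ) ∈ faceInterior (K i)) ∧
    (∀ i, 0 < faceDim (K i)) ∧
    StrictMono fun i => faceDim (K i)

/-! ### Rotationally symmetric data in dimension three -/

/-- The rotationally symmetric reflection matrix. -/
def rotR (r₁ r₂ : ℝ) : Matrix (Fin 3) (Fin 3) ℝ :=
  !![1, r₂, r₁; r₁, 1, r₂; r₂, r₁, 1]

/-- The rotationally symmetric drift `(θ₀, θ₀, θ₀)'`. -/
def rotDrift (θ₀ : ℝ) : Fin 3 → ℝ := fun _ => θ₀

/-- The set `R_f` of admissible reflection parameters. -/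
def paramSet : Set (ℝ × ℝ) :=
  {r | 0 ≤ r.1 ∧ 0 ≤ r.2 ∧ r.1 > r.2 ∧ -1 < r.1 + r.2 ∧ r.1 + r.2 < 2}

/-- The standing condition on the reflection parameters. -/
def ReflectionCondition (r₁ r₂ : ℝ) : Prop :=
  (r₁, r₂) ∈ paramSet ∧
    (1 + r₂ ^ 2) * (1 + r₁ ^ 2 - r₂ - r₁ * r₂) ^ 2 ≥
      2 * (r₁ * r₂) ^ 2 * (1 + r₁ ^ 2 + r₂ ^ 2 - r₁ - r₂ - r₁ * r₂)

end

/-! A linear piece whose driving path has increment `u ≠ 0` costs, over its best duration, `|θ₀| (√3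
‖u‖ + u₀ + u₁ + u₂) = |θ₀| * dispCost u`, and no path in `ℋ` with that increment is cheaper
(`MemH.neg_mul_dispCost_le`). Hence only breakpoints and pushes matter. A path with finitely many
pieces yields a chain that is no dearer (`exists_reach_of_hasPieces`), and every chain is realized
by a path at exactly its cost (`Reach.exists_isRealization`). What remains is finite-dimensional: an
optimal chain can be replaced by a gradual one of equal cost (`Reach.gradReach_of_optimal`).

Chains may be scaled and rotated cyclically, and `dispCost` is subadditive. A gradual chain to `p`
is prolonged by one piece to `v` (`GradReach.extend`). If `v` has fewer zero coordinates, all among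
those of `p`, the piece is appended; if the zero sets are nested in any other way, it is merged with
the previous piece. Otherwise it leaves one face and lands on another. When this leads from one axis
to another, a scaled and rotated copy of the chain to the first axis does as well
(`GradReach.of_axis`). Every other crossing violates a first-order condition
(`false_of_axis_crossing`, `false_of_face_crossing`).

For a crossing out of a two-dimensional face, the cost gradients of the last two pieces lie on the
sphere `‖ξ - 1‖² = 3`, agree along the face and are mirror images in the normal coordinate.
Optimality thus becomes a polynomial system in three reals `a`, `t`, `e` (`exists_crossing_data`),
which the first lemmas refute. The quartic condition on `r₁`, `r₂` acts through
`pos_of_reflectionCondition`. -/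

noncomputable section

/-! ### Inequalities for points of the sphere `‖ξ - 1‖² = 3` orthogonal to a reflection vector

Below `a`, `1 - t`, `e` are the coordinates of such a point. -/

/-- The sphere gives `1 - √3 ≤ e`; `-3/4` is a rational bound just below. -/
lemma neg_three_quarters_lt_of_sphere {a t e : ℝ} (hS : (a - 1) ^ 2 + t ^ 2 + (e - 1) ^ 2 = 3) :
    -(3 / 4) < e := by
  nlinarith [sq_nonneg (a - 1), sq_nonneg t]

/-- `hA` is the arrival condition on face `0` after leaving face `1`. As `r₂ < r₁` and `e > -3/4`,
the terms `r₁ * (1 + t) + r₂ * e` exceed `r₂ * t`, so `a + r₂ * t < 0`, against either form of `h`.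
-/
lemma false_of_arrival_prev {r₁ r₂ a t e : ℝ} (h2 : 0 ≤ r₂) (h12 : r₂ < r₁)
    (ht : 0 < t) (he : -(3 / 4) < e) (hA : a + r₁ * (1 + t) + r₂ * e ≤ 0)
    (h : 0 ≤ a ∨ 0 < a - 1 + r₂ * t) : False := by
  have h3 : r₂ * (-(3 / 4)) ≤ r₂ * e := mul_le_mul_of_nonneg_left he.le h2
  have h4 : 0 < (r₁ - r₂) * t := mul_pos (sub_pos.2 h12) ht
  rcases h with h | h <;> nlinarith

/-- `hA` is the arrival condition on face `2`. It forces `a = -z ≤ 0` and, with `hP`, bounds `t`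
above by an affine function of `z`, whereas `hp` asks for `r₂ * t > 1 + z`. The two are incompatible
coefficient by coefficient (`h4`, `h5`). -/
lemma false_of_arrival_next_of_nonneg {r₁ r₂ a t e : ℝ} (h2 : 0 ≤ r₂) (h12 : r₂ < r₁)
    (hsum : r₁ + r₂ < 2) (ht : 0 < t) (hP : r₂ * a + (1 - t) + r₁ * e = 0)
    (hA : r₁ * a + r₂ * (1 + t) + e ≤ 0) (he : 0 ≤ e) (hp : 0 < a - 1 + r₂ * t) : False := by
  have hr1 : 0 < r₁ := h2.trans_lt h12
  have ha : a ≤ 0 := by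
    by_contra hc
    push Not at hc
    have := mul_pos hr1 hc
    have := mul_nonneg h2 ht.le
    nlinarith
  obtain ⟨z, rfl⟩ : ∃ z, a = -z := ⟨-a, by ring⟩
  have hz : 0 ≤ z := by linarith
  have h1 : t * (1 + r₁ * r₂) ≤ 1 - r₁ * r₂ + (r₁ ^ 2 - r₂) * z := by
    have : r₁ * e ≤ r₁ * (r₁ * z - r₂ * (1 + t)) :=
      mul_le_mul_of_nonneg_left (by linarith) hr1.le
    nlinarith
  have h3 : (1 + z) * (1 + r₁ * r₂) < r₂ * (1 - r₁ * r₂ + (r₁ ^ 2 - r₂) * z) := by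
    have hq : 0 < 1 + r₁ * r₂ := by positivity
    have := mul_lt_mul_of_pos_right (show 1 + z < r₂ * t by linarith) hq
    have := mul_le_mul_of_nonneg_left h1 h2
    nlinarith
  have hr2 : r₂ < 1 := by linarith
  have h4 : r₂ * (1 - r₁ * r₂) < 1 + r₁ * r₂ := by nlinarith [mul_nonneg hr1.le h2]
  have h5 : r₂ * (r₁ ^ 2 - r₂) ≤ 1 + r₁ * r₂ := by
    have e1 : r₂ * (r₁ ^ 2 - r₁) ≤ 1 := by
      have hr2' : 0 ≤ 2 - r₁ := by linarith
      rcases le_total r₁ 1 with h | h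
      · have : r₁ ^ 2 - r₁ ≤ 0 := by nlinarith
        nlinarith
      · have h6 : 0 ≤ r₁ ^ 2 - r₁ := by nlinarith
        have h7 : r₂ * (r₁ ^ 2 - r₁) ≤ (2 - r₁) * (r₁ ^ 2 - r₁) :=
          mul_le_mul_of_nonneg_right (by linarith) h6
        -- `(2 - r₁) * (r₁ ^ 2 - r₁) = r₁ / 4 - r₁ * (r₁ - 3 / 2) ^ 2`, and `r₁ ≤ 2`.
        nlinarith [mul_nonneg hr1.le (sq_nonneg (r₁ - 3 / 2))]
    nlinarith [sq_nonneg r₂]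
  nlinarith [mul_le_mul_of_nonneg_right h5 hz]

/-- With `e = -f`, arrival gives `f ≥ r₁ * a > 0`, and `hp` then forces `r₁ > 1`. The sphere
equation makes `(1 + r₁ ^ 2) * f ^ 2` smaller than `(1 + r₂ ^ 2) * a ^ 2`, which is impossible since
`f ≥ a` and `r₂ < 1`. -/
lemma false_of_arrival_next_of_pos {r₁ r₂ a t e : ℝ} (h2 : 0 ≤ r₂) (h12 : r₂ < r₁)
    (hsum : r₁ + r₂ < 2) (ht : 0 < t) (hS : (a - 1) ^ 2 + t ^ 2 + (e - 1) ^ 2 = 3)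
    (hP : r₂ * a + (1 - t) + r₁ * e = 0)
    (hA : r₁ * a + r₂ * (1 + t) + e ≤ 0) (ha : 0 < a) (hp : 0 < e - 1 + r₁ * t) : False := by
  have hr1 : 0 < r₁ := h2.trans_lt h12
  have hr2 : r₂ < 1 := by linarith
  obtain ⟨f, rfl⟩ : ∃ f, e = -f := ⟨-e, by ring⟩
  have hf : r₁ * a ≤ f := by nlinarith
  have hf0 : 0 < f := (mul_pos hr1 ha).trans_le hf
  obtain rfl : t = 1 + r₂ * a - r₁ * f := by linarith
  have h3 : (1 + r₁ ^ 2) * f < r₁ - 1 + r₁ * r₂ * a := by nlinarith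
  -- The sphere equation after eliminating `t`.
  have h4 : f * ((1 + r₁ ^ 2) * f - 2 * (r₁ - 1) - 2 * r₁ * r₂ * a) =
      2 * a * (1 - r₂) - a ^ 2 * (1 + r₂ ^ 2) := by nlinarith
  have h5 : f * ((1 + r₁ ^ 2) * f - 2 * (r₁ - 1) - 2 * r₁ * r₂ * a) ≤
      f * (-((1 + r₁ ^ 2) * f)) :=
    mul_le_mul_of_nonneg_left (by nlinarith) hf0.le
  have h6 : (1 + r₁ ^ 2) * (r₁ * a) ≤ (1 + r₁ ^ 2) * f :=
    mul_le_mul_of_nonneg_left hf (by positivity)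
  have h7 : 1 < r₁ := by
    have : 0 ≤ r₁ * a * (1 + r₁ ^ 2 - r₂) := by
      apply mul_nonneg (by positivity); nlinarith [sq_nonneg r₁]
    nlinarith
  have h8 : (r₁ * a) ^ 2 ≤ f ^ 2 := pow_le_pow_left₀ (by positivity) hf 2
  have h9 : a ^ 2 ≤ (r₁ * a) ^ 2 := by
    rw [mul_pow]; exact le_mul_of_one_le_left (sq_nonneg a) (one_le_pow₀ h7.le)
  have h10 : 2 * f ^ 2 ≤ (1 + r₁ ^ 2) * f ^ 2 :=
    mul_le_mul_of_nonneg_right (by linarith [one_le_pow₀ (n := 2) h7.le]) (sq_nonneg f)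
  have h11 : 0 < 2 * a * (1 - r₂) := mul_pos (by linarith) (by linarith)
  have h12 : a ^ 2 * (1 + r₂ ^ 2) ≤ a ^ 2 * 2 :=
    mul_le_mul_of_nonneg_left (by nlinarith) (sq_nonneg a)
  have h13 : f * (-((1 + r₁ ^ 2) * f)) = -((1 + r₁ ^ 2) * f ^ 2) := by ring
  linarith

/-- The plane `hP` cuts the sphere in a circle, an ellipse in the coordinates `(a, e)`. Condition
`hp` selects the side, toward larger `a`, of the chord joining its points of extreme `e`. Were `a ≤
0` there, the point of largest `e` would have `a < 0`; `hC` says that it does not. -/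
lemma pos_of_reflectionCondition {r₁ r₂ a t e : ℝ} (h2 : 0 ≤ r₂) (h12 : r₂ < r₁)
    (hsum : r₁ + r₂ < 2)
    (hC : 2 * (r₁ * r₂) ^ 2 * (1 + r₁ ^ 2 + r₂ ^ 2 - r₁ - r₂ - r₁ * r₂) ≤
      (1 + r₂ ^ 2) * (1 + r₁ ^ 2 - r₂ - r₁ * r₂) ^ 2)
    (hS : (a - 1) ^ 2 + t ^ 2 + (e - 1) ^ 2 = 3)
    (hP : r₂ * a + (1 - t) + r₁ * e = 0) (hp : 0 < a - 1 + r₂ * t) : 0 < a := by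
  have hr1 : 0 < r₁ := h2.trans_lt h12
  by_contra hc
  push Not at hc
  obtain rfl : t = 1 + r₂ * a + r₁ * e := by linarith
  set N := 1 + r₁ ^ 2 + r₂ ^ 2 with hN
  have hN0 : 0 < N := by positivity
  set m := 1 + r₁ ^ 2 - r₂ - r₁ * r₂ with hm
  have hm0 : 0 < m := by nlinarith
  set k := 1 + r₂ ^ 2 - r₁ - r₁ * r₂ with hk
  set S := 1 + r₁ ^ 2 + r₂ ^ 2 - r₁ - r₂ - r₁ * r₂ with hSd
  -- `X`, `Z` are `N` times the offsets from the centre of the circle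
  set X := N * a - m with hX
  set Z := N * e - k with hZ
  have e1 : (1 + r₂ ^ 2) * X + r₁ * r₂ * Z = N * (a - 1 + r₂ * (1 + r₂ * a + r₁ * e)) := by
    simp only [hX, hZ, hm, hk, hN]; ring
  have e2 : (1 + r₂ ^ 2) * X ^ 2 + 2 * r₁ * r₂ * X * Z + (1 + r₁ ^ 2) * Z ^ 2 = 2 * S * N := by
    simp only [hX, hZ, hm, hk, hN, hSd]
    linear_combination (1 + r₁ ^ 2 + r₂ ^ 2) ^ 2 * hS
  have h1 : 0 < (1 + r₂ ^ 2) * X + r₁ * r₂ * Z := by rw [e1]; exact mul_pos hN0 hp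
  have h3 : (1 + r₂ ^ 2) * m ≤ -((1 + r₂ ^ 2) * X) := by
    have : N * a ≤ 0 := mul_nonpos_of_nonneg_of_nonpos hN0.le hc
    have e3 : (1 + r₂ ^ 2) * (m - N * a) = -((1 + r₂ ^ 2) * X) := by simp only [hX]; ring
    rw [← e3]
    exact mul_le_mul_of_nonneg_left (by linarith) (by positivity)
  have h4 : (1 + r₂ ^ 2) * m < r₁ * r₂ * Z := by linarith
  have h5 : ((1 + r₂ ^ 2) * m) ^ 2 < (r₁ * r₂ * Z) ^ 2 :=
    pow_lt_pow_left₀ h4 (by positivity) two_ne_zero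
  have h6 : N * Z ^ 2 ≤ (1 + r₂ ^ 2) * (2 * S * N) := by
    rw [← e2]
    -- Completing the square in `X`: the quadratic form has determinant `(1 + r₁ ^ 2) * (1 + r₂ ^ 2)
    -- - (r₁ * r₂) ^ 2 = N`.
    have : (1 + r₂ ^ 2) * ((1 + r₂ ^ 2) * X ^ 2 + 2 * r₁ * r₂ * X * Z + (1 + r₁ ^ 2) * Z ^ 2) =
      ((1 + r₂ ^ 2) * X + r₁ * r₂ * Z) ^ 2 + N * Z ^ 2 := by simp only [hN]; ring
    rw [this]; exact le_add_of_nonneg_left (sq_nonneg _)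
  have h7 : Z ^ 2 ≤ (1 + r₂ ^ 2) * (2 * S) := by
    by_contra hc'; push Not at hc'
    have := mul_lt_mul_of_pos_left hc' hN0
    linarith
  have h8 : (r₁ * r₂) ^ 2 * Z ^ 2 ≤ (r₁ * r₂) ^ 2 * ((1 + r₂ ^ 2) * (2 * S)) :=
    mul_le_mul_of_nonneg_left h7 (sq_nonneg _)
  have h9 := mul_le_mul_of_nonneg_left hC (show 0 ≤ 1 + r₂ ^ 2 by positivity)
  rw [mul_pow, mul_pow _ Z] at h5
  linarith

/-! ### The cost of a linear piece -/

/-- The Euclidean norm on `ℝ³`. -/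
def euclNorm (u : Fin 3 → ℝ) : ℝ := √(u 0 ^ 2 + u 1 ^ 2 + u 2 ^ 2)

/-- The time-optimal cost, in units of `|θ₀|`, of a linear piece along which the driving path
has increment `u`. -/
def dispCost (u : Fin 3 → ℝ) : ℝ := √3 * euclNorm u + (u 0 + u 1 + u 2)

/-- The gradient of `dispCost`. -/
def costGrad (u : Fin 3 → ℝ) : Fin 3 → ℝ := fun i => 1 + √3 * u i / euclNorm u

lemma euclNorm_eq_norm (u : Fin 3 → ℝ) : euclNorm u = ‖WithLp.toLp 2 u‖ := by
  simp [euclNorm, EuclideanSpace.norm_eq, Fin.sum_univ_three]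

lemma euclNorm_nonneg (u : Fin 3 → ℝ) : 0 ≤ euclNorm u := Real.sqrt_nonneg _

lemma euclNorm_sq (u : Fin 3 → ℝ) : euclNorm u ^ 2 = u 0 ^ 2 + u 1 ^ 2 + u 2 ^ 2 :=
  Real.sq_sqrt (by positivity)

lemma euclNorm_add_le (u w : Fin 3 → ℝ) : euclNorm (u + w) ≤ euclNorm u + euclNorm w := by
  simp only [euclNorm_eq_norm, WithLp.toLp_add]
  exact norm_add_le _ _

lemma euclNorm_smul {s : ℝ} (hs : 0 ≤ s) (u : Fin 3 → ℝ) : euclNorm (s • u) = s * euclNorm u := by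
  simp only [euclNorm_eq_norm, WithLp.toLp_smul, norm_smul, Real.norm_of_nonneg hs]

lemma euclNorm_pos {u : Fin 3 → ℝ} (hu : u ≠ 0) : 0 < euclNorm u := by
  rw [euclNorm_eq_norm, norm_pos_iff]
  simpa using hu

@[simp] lemma dispCost_zero : dispCost 0 = 0 := by simp [dispCost, euclNorm]

lemma dispCost_add_le (u w : Fin 3 → ℝ) : dispCost (u + w) ≤ dispCost u + dispCost w := by
  have := mul_le_mul_of_nonneg_left (euclNorm_add_le u w) (Real.sqrt_nonneg 3)
  simp only [dispCost, Pi.add_apply]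
  linarith

lemma dispCost_smul {s : ℝ} (hs : 0 ≤ s) (u : Fin 3 → ℝ) : dispCost (s • u) = s * dispCost u := by
  simp only [dispCost, euclNorm_smul hs, Pi.smul_apply, smul_eq_mul]; ring

lemma sq_sum_le (u : Fin 3 → ℝ) : (u 0 + u 1 + u 2) ^ 2 ≤ (√3 * euclNorm u) ^ 2 := by
  rw [mul_pow, Real.sq_sqrt (by norm_num), euclNorm_sq]
  nlinarith [sq_nonneg (u 0 - u 1), sq_nonneg (u 1 - u 2), sq_nonneg (u 0 - u 2)]

lemma dispCost_nonneg (u : Fin 3 → ℝ) : 0 ≤ dispCost u := by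
  have := abs_le_of_sq_le_sq' (sq_sum_le u) (mul_nonneg (Real.sqrt_nonneg 3) (euclNorm_nonneg u))
  simp only [dispCost]; linarith [this.1]

/-- Equality in Cauchy–Schwarz: only increments along the drift are free. -/
lemma exists_of_dispCost_eq_zero {u : Fin 3 → ℝ} (h : dispCost u = 0) :
    ∃ s, 0 ≤ s ∧ ∀ i, u i = -s := by
  have h1 : (u 0 + u 1 + u 2) ^ 2 = (√3 * euclNorm u) ^ 2 := by
    simp only [dispCost] at h
    rw [show √3 * euclNorm u = -(u 0 + u 1 + u 2) by linarith]; ring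
  rw [mul_pow, Real.sq_sqrt (by norm_num), euclNorm_sq] at h1
  have a : u 0 = u 1 := by
    nlinarith [sq_nonneg (u 0 - u 1), sq_nonneg (u 1 - u 2), sq_nonneg (u 0 - u 2)]
  have b : u 1 = u 2 := by
    nlinarith [sq_nonneg (u 0 - u 1), sq_nonneg (u 1 - u 2), sq_nonneg (u 0 - u 2)]
  have c : 0 ≤ √3 * euclNorm u := mul_nonneg (Real.sqrt_nonneg 3) (euclNorm_nonneg u)
  simp only [dispCost] at h
  refine ⟨-u 0, by linarith, fun i => ?_⟩
  fin_cases i <;> simp <;> linarith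

lemma costGrad_dotProduct_self {u : Fin 3 → ℝ} (hu : 0 < euclNorm u) :
    costGrad u ⬝ᵥ u = dispCost u := by
  have : √3 * (u 0 ^ 2 + u 1 ^ 2 + u 2 ^ 2) / euclNorm u = √3 * euclNorm u := by
    rw [← euclNorm_sq]; field_simp
  rw [dispCost, ← this]
  simp only [costGrad, dotProduct, Fin.sum_univ_three]
  field_simp; ring

lemma costGrad_sphere {u : Fin 3 → ℝ} (hu : 0 < euclNorm u) :
    (costGrad u 0 - 1) ^ 2 + (costGrad u 1 - 1) ^ 2 + (costGrad u 2 - 1) ^ 2 = 3 := by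
  have h3 : (√3) ^ 2 = 3 := Real.sq_sqrt (by norm_num)
  simp only [costGrad, add_sub_cancel_left, div_pow, mul_pow, h3]
  rw [← add_div, ← add_div, ← mul_add, ← mul_add, ← euclNorm_sq]
  field_simp

/-- The square root lies below its tangent. This one-sided quadratic bound takes the place of
differentiability in the variations. -/
lemma dispCost_add_smul_le {u : Fin 3 → ℝ} (hu : 0 < euclNorm u) (w : Fin 3 → ℝ) (ε : ℝ) :
    dispCost (u + ε • w) ≤ dispCost u + ε * (costGrad u ⬝ᵥ w) +
      ε ^ 2 * (√3 * euclNorm w ^ 2 / (2 * euclNorm u)) := by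
  set n := euclNorm u with hn
  set d := u 0 * w 0 + u 1 * w 1 + u 2 * w 2 with hd
  have hsq := euclNorm_sq u
  rw [← hn] at hsq
  have key : euclNorm (u + ε • w) ≤ n + (2 * ε * d + ε ^ 2 * euclNorm w ^ 2) / (2 * n) := by
    have hid : (u + ε • w) 0 ^ 2 + (u + ε • w) 1 ^ 2 + (u + ε • w) 2 ^ 2 =
        n ^ 2 + (2 * ε * d + ε ^ 2 * euclNorm w ^ 2) := by
      rw [hsq, euclNorm_sq]; simp [hd]; ring
    have hnn : 0 ≤ n ^ 2 + (2 * ε * d + ε ^ 2 * euclNorm w ^ 2) := by rw [← hid]; positivity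
    rw [euclNorm, hid]
    set B := 2 * ε * d + ε ^ 2 * euclNorm w ^ 2
    apply Real.sqrt_le_iff.2
    constructor
    · rw [show n + B / (2 * n) = (n ^ 2 + (n ^ 2 + B)) / (2 * n) by field_simp; ring]
      positivity
    · have : (n + B / (2 * n)) ^ 2 = n ^ 2 + B + (B / (2 * n)) ^ 2 := by field_simp; ring
      rw [this]; linarith [sq_nonneg (B / (2 * n))]
  have h2 := mul_le_mul_of_nonneg_left key (Real.sqrt_nonneg 3)
  have h4 : costGrad u ⬝ᵥ w = w 0 + w 1 + w 2 + √3 * d / n := by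
    simp only [costGrad, dotProduct, Fin.sum_univ_three, ← hn, hd]; field_simp; ring
  have h5 : √3 * (n + (2 * ε * d + ε ^ 2 * euclNorm w ^ 2) / (2 * n)) =
      √3 * n + ε * (√3 * d / n) + ε ^ 2 * (√3 * euclNorm w ^ 2 / (2 * n)) := by
    field_simp; ring
  rw [h4]
  simp only [dispCost, ← hn, Pi.add_apply, Pi.smul_apply, smul_eq_mul]
  nlinarith

lemma nonneg_of_forall_small {α β δ : ℝ} (hδ : 0 < δ)
    (H : ∀ ε, 0 < ε → ε < δ → 0 ≤ ε * α + ε ^ 2 * β) : 0 ≤ α := by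
  by_contra hα
  push Not at hα
  have hb : 0 < |β| + 1 := by positivity
  set ε := min (δ / 2) (-α / (|β| + 1) / 2) with hε
  have h1 : 0 < ε := lt_min (by linarith) (by have := div_pos (neg_pos.2 hα) hb; linarith)
  have h2 : ε ≤ -α / (|β| + 1) / 2 := min_le_right _ _
  have h3 : ε * (|β| + 1) ≤ -α / 2 := by
    calc ε * (|β| + 1) ≤ (-α / (|β| + 1) / 2) * (|β| + 1) := mul_le_mul_of_nonneg_right h2 hb.le
      _ = -α / 2 := by field_simp
  have h4 := H ε h1 ((min_le_left _ _).trans_lt (by linarith))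
  have h5 : 0 ≤ α + ε * β := by
    by_contra hc; push Not at hc
    have := mul_neg_of_pos_of_neg h1 hc
    nlinarith
  have h6 : ε * β ≤ ε * |β| := mul_le_mul_of_nonneg_left (le_abs_self β) h1.le
  linarith

/-- First-order condition for perturbations of two linear pieces. -/
lemma nonneg_first_variation {u₁ u₂ w₁ w₂ : Fin 3 → ℝ} {k δ : ℝ} (h₁ : 0 < euclNorm u₁)
    (h₂ : 0 < euclNorm u₂) (hδ : 0 < δ)
    (H : ∀ ε, 0 < ε → ε < δ → dispCost u₁ + dispCost u₂ ≤
      k * ε + dispCost (u₁ + ε • w₁) + dispCost (u₂ + ε • w₂)) :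
    0 ≤ k + costGrad u₁ ⬝ᵥ w₁ + costGrad u₂ ⬝ᵥ w₂ := by
  refine nonneg_of_forall_small (β := √3 * euclNorm w₁ ^ 2 / (2 * euclNorm u₁) +
    √3 * euclNorm w₂ ^ 2 / (2 * euclNorm u₂)) hδ fun ε h0 h1 => ?_
  have := H ε h0 h1
  have := dispCost_add_smul_le h₁ w₁ ε
  have := dispCost_add_smul_le h₂ w₂ ε
  linarith

/-! ### Chains of linear pieces -/

/-- `Reach r₁ r₂ v C`: a finite chain of linear pieces leads from the origin to `v` at
cost `C`. -/
inductive Reach (r₁ r₂ : ℝ) : (Fin 3 → ℝ) → ℝ → Prop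
  | zero : Reach r₁ r₂ 0 0
  | step {p v y : Fin 3 → ℝ} {C : ℝ} (hp : Reach r₁ r₂ p C) (hv : ∀ i, 0 ≤ v i)
      (hy : ∀ i, 0 ≤ y i) (hs : ∀ i, y i = 0 ∨ p i = 0 ∧ v i = 0) :
      Reach r₁ r₂ v (C + dispCost (v - p - rotR r₁ r₂ *ᵥ y))

/-- `GradReach r₁ r₂ v C`: a chain of linear pieces in faces of strictly increasing dimension
leads from the origin to `v` at cost `C`. -/
inductive GradReach (r₁ r₂ : ℝ) : (Fin 3 → ℝ) → ℝ → Prop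
  | zero : GradReach r₁ r₂ 0 0
  | step {p v y : Fin 3 → ℝ} {C : ℝ} (hp : GradReach r₁ r₂ p C) (hv : ∀ i, 0 ≤ v i)
      (hy : ∀ i, 0 ≤ y i) (hs : ∀ i, y i = 0 ∨ v i = 0) (hsub : ∀ i, v i = 0 → p i = 0)
      (hne : ∃ i, p i = 0 ∧ v i ≠ 0) :
      GradReach r₁ r₂ v (C + dispCost (v - p - rotR r₁ r₂ *ᵥ y))

variable {r₁ r₂ : ℝ}

lemma GradReach.reach {v : Fin 3 → ℝ} {C : ℝ} (h : GradReach r₁ r₂ v C) : Reach r₁ r₂ v C := by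
  induction h with
  | zero => exact .zero
  | step _ hv hy hs hsub _ ih =>
    exact .step ih hv hy fun i => (hs i).imp_right fun h => ⟨hsub i h, h⟩

lemma Reach.nonneg {v : Fin 3 → ℝ} {C : ℝ} (h : Reach r₁ r₂ v C) : ∀ i, 0 ≤ v i := by
  cases h with
  | zero => simp
  | step _ hv => exact hv

lemma Reach.cost_nonneg {v : Fin 3 → ℝ} {C : ℝ} (h : Reach r₁ r₂ v C) : 0 ≤ C := by
  induction h with
  | zero => exact le_rfl
  | step _ _ _ _ ih => exact add_nonneg ih (dispCost_nonneg _)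

/-! ### Homogeneity and rotational symmetry of chains -/

lemma smul_increment (s : ℝ) (v p y : Fin 3 → ℝ) :
    s • v - s • p - rotR r₁ r₂ *ᵥ (s • y) = s • (v - p - rotR r₁ r₂ *ᵥ y) := by
  rw [Matrix.mulVec_smul, smul_sub, smul_sub]

lemma Reach.smul {v : Fin 3 → ℝ} {C s : ℝ} (hs : 0 < s) (h : Reach r₁ r₂ v C) :
    Reach r₁ r₂ (s • v) (s * C) := by
  induction h with
  | zero => simpa using Reach.zero
  | @step p v y C _ hv hy hsp ih =>
    rw [mul_add, ← dispCost_smul hs.le, ← smul_increment]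
    refine .step ih (fun i => mul_nonneg hs.le (hv i)) (fun i => mul_nonneg hs.le (hy i)) fun i => ?_
    simpa [hs.ne'] using hsp i

lemma GradReach.smul {v : Fin 3 → ℝ} {C s : ℝ} (hs : 0 < s) (h : GradReach r₁ r₂ v C) :
    GradReach r₁ r₂ (s • v) (s * C) := by
  induction h with
  | zero => simpa using GradReach.zero
  | @step p v y C _ hv hy hsp hsub hne ih =>
    rw [mul_add, ← dispCost_smul hs.le, ← smul_increment]
    refine .step ih (fun i => mul_nonneg hs.le (hv i)) (fun i => mul_nonneg hs.le (hy i))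
      (fun i => ?_) (fun i => ?_) ?_
    · simpa [hs.ne'] using hsp i
    · simpa [hs.ne'] using hsub i
    · simpa [hs.ne'] using hne

/-- The cyclic shift of coordinates. -/
def cyclicShift (k : Fin 3) (v : Fin 3 → ℝ) : Fin 3 → ℝ := fun i => v (i + k)

@[simp] lemma cyclicShift_apply (k : Fin 3) (v : Fin 3 → ℝ) (i : Fin 3) :
    cyclicShift k v i = v (i + k) := rfl

lemma dispCost_cyclicShift (k : Fin 3) (u : Fin 3 → ℝ) : dispCost (cyclicShift k u) = dispCost u := by
  fin_cases k
  · simp [dispCost, euclNorm]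
  · simp only [dispCost, euclNorm, cyclicShift_apply, Fin.mk_one, zero_add, Fin.reduceAdd]
    rw [show u 1 ^ 2 + u 2 ^ 2 + u 0 ^ 2 = u 0 ^ 2 + u 1 ^ 2 + u 2 ^ 2 by ring]; ring
  · simp only [dispCost, euclNorm, cyclicShift_apply, Fin.reduceFinMk, zero_add, Fin.reduceAdd]
    rw [show u 2 ^ 2 + u 0 ^ 2 + u 1 ^ 2 = u 0 ^ 2 + u 1 ^ 2 + u 2 ^ 2 by ring]; ring

lemma rotR_mulVec_zero (y : Fin 3 → ℝ) :
    (rotR r₁ r₂ *ᵥ y) 0 = y 0 + r₂ * y 1 + r₁ * y 2 := by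
  simp [rotR, Matrix.mulVec, dotProduct, Fin.sum_univ_three]

lemma rotR_mulVec_one (y : Fin 3 → ℝ) :
    (rotR r₁ r₂ *ᵥ y) 1 = r₁ * y 0 + y 1 + r₂ * y 2 := by
  simp [rotR, Matrix.mulVec, dotProduct, Fin.sum_univ_three]

lemma rotR_mulVec_two (y : Fin 3 → ℝ) :
    (rotR r₁ r₂ *ᵥ y) 2 = r₂ * y 0 + r₁ * y 1 + y 2 := by
  simp [rotR, Matrix.mulVec, dotProduct, Fin.sum_univ_three]

lemma cyclicShift_increment (k : Fin 3) (v p y : Fin 3 → ℝ) :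
    cyclicShift k v - cyclicShift k p - rotR r₁ r₂ *ᵥ (cyclicShift k y) =
      cyclicShift k (v - p - rotR r₁ r₂ *ᵥ y) := by
  ext i
  fin_cases k <;> fin_cases i <;>
    simp only [Pi.sub_apply, cyclicShift_apply, rotR_mulVec_zero, rotR_mulVec_one, rotR_mulVec_two,
      Fin.zero_eta, Fin.mk_one, Fin.reduceFinMk, zero_add, add_zero, Fin.reduceAdd] <;> ring

lemma Reach.rotate {v : Fin 3 → ℝ} {C : ℝ} (k : Fin 3) (h : Reach r₁ r₂ v C) :
    Reach r₁ r₂ (cyclicShift k v) C := by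
  induction h with
  | zero => exact Reach.zero
  | @step p v y C _ hv hy hsp ih =>
    rw [← dispCost_cyclicShift k, ← cyclicShift_increment]
    exact .step ih (fun i => hv _) (fun i => hy _) fun i => hsp _

lemma GradReach.rotate {v : Fin 3 → ℝ} {C : ℝ} (k : Fin 3) (h : GradReach r₁ r₂ v C) :
    GradReach r₁ r₂ (cyclicShift k v) C := by
  induction h with
  | zero => exact GradReach.zero
  | @step p v y C _ hv hy hsp hsub hne ih =>
    rw [← dispCost_cyclicShift k, ← cyclicShift_increment]
    obtain ⟨i, hi⟩ := hne
    exact .step ih (fun i => hv _) (fun i => hy _) (fun i => hsp _) (fun i => hsub _)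
      ⟨i - k, by simpa using hi⟩

lemma cyclicShift_neg_cyclicShift (k : Fin 3) (v : Fin 3 → ℝ) :
    cyclicShift (-k) (cyclicShift k v) = v := by
  ext i; simp [add_assoc]

/-! ### First-order conditions for optimal chains -/

/-- The columns of the reflection matrix. -/
def reflCol (r₁ r₂ : ℝ) (j : Fin 3) : Fin 3 → ℝ := fun i => rotR r₁ r₂ i j

lemma rotR_mulVec_single (j : Fin 3) (η : ℝ) :
    rotR r₁ r₂ *ᵥ Pi.single j η = η • reflCol r₁ r₂ j := by
  ext i; simp [reflCol, Matrix.mulVec_single, mul_comm]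

lemma reflCol_self (j : Fin 3) : reflCol r₁ r₂ j j = 1 := by
  fin_cases j <;> simp [reflCol, rotR]

lemma reflCol_zero : reflCol r₁ r₂ 0 0 = 1 ∧ reflCol r₁ r₂ 0 1 = r₁ ∧ reflCol r₁ r₂ 0 2 = r₂ := by
  simp [reflCol, rotR]

lemma reflCol_one : reflCol r₁ r₂ 1 0 = r₂ ∧ reflCol r₁ r₂ 1 1 = 1 ∧ reflCol r₁ r₂ 1 2 = r₁ := by
  simp [reflCol, rotR]

lemma reflCol_two : reflCol r₁ r₂ 2 0 = r₁ ∧ reflCol r₁ r₂ 2 1 = r₂ ∧ reflCol r₁ r₂ 2 2 = 1 := by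
  simp [reflCol, rotR]

lemma Reach.step_single {p v : Fin 3 → ℝ} {C η : ℝ} (j : Fin 3) (hp : Reach r₁ r₂ p C)
    (hv : ∀ i, 0 ≤ v i) (hη : 0 ≤ η) (hpj : p j = 0) (hvj : v j = 0) :
    Reach r₁ r₂ v (C + dispCost (v - p - η • reflCol r₁ r₂ j)) := by
  rw [← rotR_mulVec_single]
  refine .step hp hv (fun i => ?_) fun i => ?_ <;>
    rcases eq_or_ne i j with rfl | h <;> simp [*]

lemma Reach.step_free {p v : Fin 3 → ℝ} {C : ℝ} (hp : Reach r₁ r₂ p C) (hv : ∀ i, 0 ≤ v i) :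
    Reach r₁ r₂ v (C + dispCost (v - p)) := by
  simpa using Reach.step (y := 0) hp hv (by simp) (by simp)

lemma exists_forall_sub_mul_nonneg {v w : Fin 3 → ℝ} (hv : ∀ i, 0 ≤ v i)
    (hw : ∀ i, 0 < v i ∨ w i ≤ 0) :
    ∃ δ, 0 < δ ∧ ∀ ε, 0 < ε → ε < δ → ∀ i, 0 ≤ v i - ε * w i := by
  have h : ∀ i, ∃ δ, 0 < δ ∧ ∀ ε, 0 < ε → ε < δ → 0 ≤ v i - ε * w i := by
    intro i
    rcases hw i with h | h
    · refine ⟨v i / (|w i| + 1), by positivity, fun ε h0 h1 => ?_⟩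
      rw [lt_div_iff₀ (by positivity)] at h1
      have := mul_le_mul_of_nonneg_left (le_abs_self (w i)) h0.le
      linarith
    · exact ⟨1, one_pos, fun ε h0 _ => by
        have := mul_nonpos_of_nonneg_of_nonpos h0.le h
        linarith [hv i]⟩
  choose δ hδ H using h
  refine ⟨min (δ 0) (min (δ 1) (δ 2)), lt_min (hδ 0) (lt_min (hδ 1) (hδ 2)), fun ε h0 h1 i => ?_⟩
  refine H i ε h0 (h1.trans_le ?_)
  fin_cases i <;> simp

/-- A free piece that ends on the face `j` of an optimal chain cannot be improved by reaching that
face earlier. -/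
lemma costGrad_dotProduct_reflCol_nonpos {p v : Fin 3 → ℝ} {C : ℝ} (j : Fin 3)
    (hp : Reach r₁ r₂ p C) (hv : ∀ i, 0 ≤ v i) (hvj : v j = 0) (hpj : 0 < p j)
    (hopt : ∀ C', Reach r₁ r₂ v C' → C + dispCost (v - p) ≤ C')
    (hw : ∀ i, 0 < v i ∨ v i - p i + p j * reflCol r₁ r₂ j i ≤ 0) :
    costGrad (v - p) ⬝ᵥ reflCol r₁ r₂ j ≤ 0 := by
  have hu : 0 < euclNorm (v - p) := euclNorm_pos fun h => by
    have := congrFun h j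
    simp [hvj] at this; linarith
  obtain ⟨δ, hδ, H⟩ := exists_forall_sub_mul_nonneg
    (w := v - p + p j • reflCol r₁ r₂ j) hv (by simpa using hw)
  -- The competitor reaches the face at `v - ε • w` and then runs inside it with push `ε * p j`. The
  -- choice of `w` gives `w j = 0` and makes the second increment exactly `ε • (v - p)`, whose cost
  -- enters through `k`. The first piece `u₁` is an idle copy.
  have key := nonneg_first_variation (u₁ := v - p) (u₂ := v - p) (w₁ := 0)
    (w₂ := -(v - p + p j • reflCol r₁ r₂ j)) (k := dispCost (v - p)) hu hu hδ fun ε h0 h1 => by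
      set w := v - p + p j • reflCol r₁ r₂ j with hwd
      have a : Reach r₁ r₂ (v - ε • w) (C + dispCost (v - ε • w - p)) :=
        hp.step_free fun i => by simpa using H ε h0 h1 i
      have hwj : (v - ε • w) j = 0 := by simp [hwd, hvj, reflCol_self]
      have b := a.step_single j hv (mul_nonneg h0.le hpj.le) hwj hvj
      have c := hopt _ b
      rw [show v - (v - ε • w) - (ε * p j) • reflCol r₁ r₂ j = ε • (v - p) by
        rw [hwd]; module, dispCost_smul h0.le,
        show v - ε • w - p = v - p + ε • -w by module] at c
      simp only [smul_zero, add_zero]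
      linarith
  rw [dotProduct_zero, dotProduct_neg, dotProduct_add, costGrad_dotProduct_self hu,
    dotProduct_smul, smul_eq_mul] at key
  by_contra hc
  push Not at hc
  have := mul_pos hpj hc
  linarith

/-- A chain which follows an axis and then crosses the interior to the opposite face is not
optimal. -/
lemma false_of_axis_crossing {p v : Fin 3 → ℝ} {C : ℝ} (h2 : 0 ≤ r₂) (h12 : r₂ < r₁)
    (hp : Reach r₁ r₂ p C) (hp0 : 0 < p 0) (hp1 : p 1 = 0) (hp2 : p 2 = 0)
    (hv0 : v 0 = 0) (hv1 : 0 < v 1) (hv2 : 0 < v 2)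
    (hopt : ∀ C', Reach r₁ r₂ v C' → C + dispCost (v - p) ≤ C') : False := by
  have hv : ∀ i, 0 ≤ v i := by
    intro i; fin_cases i <;> simp [hv0, hv1.le, hv2.le]
  have hu : 0 < euclNorm (v - p) := euclNorm_pos fun h => by
    have := congrFun h 0
    simp [hv0] at this; linarith
  have harr := costGrad_dotProduct_reflCol_nonpos 0 hp hv hv0 hp0 hopt fun i => by
    fin_cases i
    · right; simp [hv0, reflCol_self]
    · left; simpa using hv1
    · left; simpa using hv2
  -- Shrinking the chain to `p` by the factor `1 - ε` saves `ε * C`; hence `C ≤ costGrad (v - p) ⬝ᵥ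
  -- p`, and `costGrad (v - p) 0` cannot be negative.
  have key := nonneg_first_variation (u₁ := v - p) (u₂ := v - p) (w₁ := 0)
    (w₂ := p) (k := -C) hu hu one_pos fun ε h0 h1 => by
      have a := hopt _ ((hp.smul (s := 1 - ε) (by linarith)).step_free hv)
      rw [show v - (1 - ε) • p = v - p + ε • p by module] at a
      simp only [smul_zero, add_zero]
      linarith
  have h3 : 0 < √3 := by positivity
  have g1 : 1 < costGrad (v - p) 1 := by
    simp only [costGrad, Pi.sub_apply, hp1, sub_zero]
    have : 0 < √3 * v 1 / euclNorm (v - p) := by positivity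
    linarith
  have g2 : 1 < costGrad (v - p) 2 := by
    simp only [costGrad, Pi.sub_apply, hp2, sub_zero]
    have : 0 < √3 * v 2 / euclNorm (v - p) := by positivity
    linarith
  obtain ⟨c0, c1, c2⟩ := reflCol_zero (r₁ := r₁) (r₂ := r₂)
  simp only [dotProduct, Fin.sum_univ_three, c0, c1, c2, hp1, hp2] at harr key
  have g0 : 0 ≤ costGrad (v - p) 0 := by
    by_contra hc; push Not at hc
    have := mul_neg_of_neg_of_pos hc hp0
    have := hp.cost_nonneg
    simp at key
    linarith
  have hr1 : 0 < r₁ := h2.trans_lt h12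
  nlinarith [mul_pos hr1 (one_pos.trans g1), mul_nonneg h2 (one_pos.trans g2).le]

/-- The first-order conditions for an optimal chain whose last two pieces run inside the face `1`
and across the interior. -/
lemma exists_crossing_data {p₀ p v : Fin 3 → ℝ} {C η : ℝ} (h0 : Reach r₁ r₂ p₀ C)
    (hp01 : p₀ 1 = 0) (hp1 : p 1 = 0) (hpa : 0 < p 0) (hpb : 0 < p 2) (hη : 0 ≤ η)
    (hne : p ≠ p₀) (hv : ∀ i, 0 ≤ v i) (hv1 : 0 < v 1)
    (hopt : ∀ C', Reach r₁ r₂ v C' →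
      C + dispCost (p - p₀ - η • reflCol r₁ r₂ 1) + dispCost (v - p) ≤ C') :
    ∃ a t e : ℝ, 0 < t ∧ (a - 1) ^ 2 + t ^ 2 + (e - 1) ^ 2 = 3 ∧
      r₂ * a + (1 - t) + r₁ * e = 0 ∧ (p₀ 0 < p 0 → 0 < a - 1 + r₂ * t) ∧
      (p₀ 2 < p 2 → 0 < e - 1 + r₁ * t) ∧ a * p₀ 0 + e * p₀ 2 = C ∧
      (v 0 = 0 → 0 < v 2 ∨ v 2 - p 2 + p 0 * r₂ ≤ 0 → a + r₁ * (1 + t) + r₂ * e ≤ 0) ∧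
      (v 2 = 0 → 0 < v 0 ∨ v 0 - p 0 + p 2 * r₁ ≤ 0 → r₁ * a + r₂ * (1 + t) + e ≤ 0) := by
  obtain ⟨c0, c1, c2⟩ := reflCol_one (r₁ := r₁) (r₂ := r₂)
  have hp : ∀ i, 0 ≤ p i := by
    intro i; fin_cases i <;> simp [hp1, hpa.le, hpb.le]
  set c := reflCol r₁ r₂ 1 with hc
  set u₁ := p - p₀ - η • c with hu1
  set u₂ := v - p with hu2
  have hu1ne : u₁ ≠ 0 := by
    intro h
    have h1 := congrFun h 1
    simp [hu1, hp1, hp01, c1] at h1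
    rw [hu1, h1, zero_smul, sub_zero, sub_eq_zero] at h
    exact hne h
  have hn1 : 0 < euclNorm u₁ := euclNorm_pos hu1ne
  have hn2 : 0 < euclNorm u₂ := euclNorm_pos fun h => by
    have := congrFun h 1
    simp [hu2, hp1] at this; linarith
  have h3 : 0 < √3 := by positivity
  have hreachp : Reach r₁ r₂ p (C + dispCost u₁) := h0.step_single 1 hp hη hp01 hp1
  -- variation of the reflection
  have vy : 0 ≤ -(costGrad u₁ ⬝ᵥ c) := by
    have := nonneg_first_variation (w₁ := -c) (w₂ := 0) (k := 0) hn1 hn2 one_pos fun ε e0 e1 => by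
      have := hopt _ ((h0.step_single 1 hp (add_nonneg hη e0.le) hp01 hp1).step_free hv)
      rw [show p - p₀ - (η + ε) • c = u₁ + ε • -c by rw [hu1]; module] at this
      simp only [smul_zero, add_zero]; linarith
    simpa using this
  have vy' : 0 < η → 0 ≤ costGrad u₁ ⬝ᵥ c := fun hη0 => by
    have := nonneg_first_variation (w₁ := c) (w₂ := 0) (k := 0) hn1 hn2 hη0 fun ε e0 e1 => by
      have := hopt _ ((h0.step_single (η := η - ε) 1 hp (by linarith) hp01 hp1).step_free hv)
      rw [show p - p₀ - (η - ε) • c = u₁ + ε • c by rw [hu1]; module] at this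
      simp only [smul_zero, add_zero]; linarith
    simpa using this
  -- variation of the exit point
  have vp : ∀ d : Fin 3 → ℝ, d 1 = 0 → 0 ≤ costGrad u₁ ⬝ᵥ d - costGrad u₂ ⬝ᵥ d := fun d hd => by
    obtain ⟨δ, hδ, H⟩ := exists_forall_sub_mul_nonneg (w := -d) hp fun i => by
      fin_cases i
      · exact Or.inl hpa
      · right; simp [hd]
      · exact Or.inl hpb
    have := nonneg_first_variation (w₁ := d) (w₂ := -d) (k := 0) hn1 hn2 hδ fun ε e0 e1 => by
      have := hopt _ ((h0.step_single (v := p + ε • d) 1 (fun i => by simpa using H ε e0 e1 i)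
        hη hp01 (by simp [hp1, hd])).step_free hv)
      rw [show p + ε • d - p₀ - η • c = u₁ + ε • d by rw [hu1]; module,
        show v - (p + ε • d) = u₂ + ε • -d by rw [hu2]; module] at this
      linarith
    simpa [sub_eq_add_neg] using this
  have veq : ∀ j, j ≠ 1 → costGrad u₁ j = costGrad u₂ j := fun j hj => by
    have a := vp (Pi.single j 1) (by simp [hj.symm])
    have b := vp (-Pi.single j 1) (by simp [hj.symm])
    simp at a b
    linarith
  have q0 := veq 0 (by decide)
  have q2 := veq 2 (by decide)
  -- variation of the starting point
  have v0 : costGrad u₁ ⬝ᵥ p₀ = C := by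
    have a := nonneg_first_variation (w₁ := p₀) (w₂ := 0) (k := -C) hn1 hn2 one_pos
      fun ε e0 e1 => by
      have := hopt _ (((h0.smul (s := 1 - ε) (by linarith)).step_single 1 hp hη
        (by simp [hp01]) hp1).step_free hv)
      rw [show p - (1 - ε) • p₀ - η • c = u₁ + ε • p₀ by rw [hu1]; module] at this
      simp only [smul_zero, add_zero]; linarith
    have b := nonneg_first_variation (w₁ := -p₀) (w₂ := 0) (k := C) hn1 hn2 one_pos
      fun ε e0 e1 => by
      have := hopt _ (((h0.smul (s := 1 + ε) (by linarith)).step_single 1 hp hη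
        (by simp [hp01]) hp1).step_free hv)
      rw [show p - (1 + ε) • p₀ - η • c = u₁ + ε • -p₀ by rw [hu1]; module] at this
      simp only [smul_zero, add_zero]; linarith
    simp at a b
    linarith
  have s1 := costGrad_sphere hn1
  have s2 := costGrad_sphere hn2
  have ht : 0 < costGrad u₂ 1 - 1 := by
    have : 0 < √3 * v 1 / euclNorm u₂ := by positivity
    simpa [costGrad, hu2, hp1] using this
  have hle : costGrad u₁ 1 = 1 - √3 * η / euclNorm u₁ := by
    simp [costGrad, hu1, hp1, hp01, c1]; ring
  have hle' : costGrad u₁ 1 ≤ 1 := by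
    rw [hle]; have : 0 ≤ √3 * η / euclNorm u₁ := by positivity
    linarith
  -- Both gradients lie on the sphere and share coordinates `0` and `2`, so their coordinates `1`
  -- are equal or symmetric about `1`; equality fails as one is above `1` and the other is not.
  have q1 : costGrad u₁ 1 = 1 - (costGrad u₂ 1 - 1) := by
    rw [q0, q2] at s1
    have : (costGrad u₁ 1 - 1) ^ 2 = (costGrad u₂ 1 - 1) ^ 2 := by linarith
    rcases sq_eq_sq_iff_eq_or_eq_neg.1 this with h | h <;> linarith
  have hη0 : 0 < η := by
    rcases hη.eq_or_lt with h | h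
    · rw [hle, ← h] at q1; simp at q1; linarith
    · exact h
  have perp : costGrad u₁ ⬝ᵥ c = 0 := le_antisymm (by linarith) (vy' hη0)
  simp only [dotProduct, Fin.sum_univ_three, c0, c1, c2, q0, q1, q2, hp01] at perp v0
  -- Inverting the gradient: `u₁` is `euclNorm u₁ / √3` times `costGrad u₁ - 1`, and `η` is the same
  -- multiple of `t = costGrad u₂ 1 - 1`.
  have pos : ∀ j, p j - p₀ j = euclNorm u₁ / √3 *
      (costGrad u₁ j - 1 + c j * (costGrad u₂ 1 - 1)) := fun j => by
    have e1 : costGrad u₂ 1 - 1 = √3 * η / euclNorm u₁ := by linarith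
    rw [e1]
    simp only [costGrad, hu1, Pi.sub_apply, Pi.smul_apply, smul_eq_mul]
    rw [← hu1]; field_simp; ring
  have hκ : 0 < euclNorm u₁ / √3 := by positivity
  refine ⟨costGrad u₂ 0, costGrad u₂ 1 - 1, costGrad u₂ 2, ht, s2, by linarith,
    fun h => ?_, fun h => ?_, by linarith, fun hv0 h => ?_, fun hv2 h => ?_⟩
  · have := pos 0
    rw [q0, c0] at this
    exact pos_of_mul_pos_right (by linarith : 0 < euclNorm u₁ / √3 * _) hκ.le
  · have := pos 2
    rw [q2, c2] at this
    exact pos_of_mul_pos_right (by linarith : 0 < euclNorm u₁ / √3 * _) hκ.le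
  · obtain ⟨b0, b1, b2⟩ := reflCol_zero (r₁ := r₁) (r₂ := r₂)
    have := costGrad_dotProduct_reflCol_nonpos 0 hreachp hv hv0 hpa hopt fun i => by
      fin_cases i
      · right; simp [hv0, b0]
      · exact Or.inl hv1
      · simpa [b2] using h
    simp only [dotProduct, Fin.sum_univ_three, b0, b1, b2, ← hu2] at this
    linarith
  · obtain ⟨b0, b1, b2⟩ := reflCol_two (r₁ := r₁) (r₂ := r₂)
    have := costGrad_dotProduct_reflCol_nonpos 2 hreachp hv hv2 hpb hopt fun i => by
      fin_cases i
      · simpa [b0] using h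
      · exact Or.inl hv1
      · right; simp [hv2, b2]
    simp only [dotProduct, Fin.sum_univ_three, b0, b1, b2, ← hu2] at this
    linarith

/-- A chain which leaves the face `1` through the interior and arrives at another face, where its
last point before the piece in the face `1` is `p₀`, is not optimal. -/
lemma false_of_face_crossing (h2 : 0 ≤ r₂) (h12 : r₂ < r₁) (hsum : r₁ + r₂ < 2)
    (hC : 2 * (r₁ * r₂) ^ 2 * (1 + r₁ ^ 2 + r₂ ^ 2 - r₁ - r₂ - r₁ * r₂) ≤
      (1 + r₂ ^ 2) * (1 + r₁ ^ 2 - r₂ - r₁ * r₂) ^ 2)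
    {p₀ p v : Fin 3 → ℝ} {C η : ℝ} (h0 : Reach r₁ r₂ p₀ C)
    (hp01 : p₀ 1 = 0) (hp1 : p 1 = 0) (hpa : 0 < p 0) (hpb : 0 < p 2) (hη : 0 ≤ η)
    (hv : ∀ i, 0 ≤ v i) (hv1 : 0 < v 1)
    (hopt : ∀ C', Reach r₁ r₂ v C' →
      C + dispCost (p - p₀ - η • reflCol r₁ r₂ 1) + dispCost (v - p) ≤ C')
    (hstart : (p₀ 0 = 0 ∧ p₀ 2 = 0) ∨ (v 0 ≠ 0 ∨ v 2 ≠ 0) ∧ 0 < C ∧ (p₀ 0 = 0 ∨ p₀ 2 = 0))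
    (hend : v 0 = 0 ∨ v 2 = 0) : False := by
  have hne : p ≠ p₀ := by
    rintro rfl
    rcases hstart with h | ⟨_, _, h | h⟩ <;> linarith
  have hr1 : 0 < r₁ := h2.trans_lt h12
  obtain ⟨a, t, e, ht, hS, hP, hpos0, hpos2, hcost, harr0, harr2⟩ :=
    exists_crossing_data h0 hp01 hp1 hpa hpb hη hne hv hv1 hopt
  have he := neg_three_quarters_lt_of_sphere hS
  have hnn := h0.nonneg
  rcases hstart with ⟨z0, z2⟩ | ⟨hv02, hC0, hz⟩
  · have ga := hpos0 (by rw [z0]; exact hpa)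
    have ge := hpos2 (by rw [z2]; exact hpb)
    have ha := pos_of_reflectionCondition h2 h12 hsum hC hS hP ga
    rcases (hv 0).eq_or_lt with w0 | w0
    · rcases (hv 2).eq_or_lt with w2 | w2
      · rcases le_or_gt (v 2 - p 2 + p 0 * r₂) 0 with h | h
        · exact false_of_arrival_prev h2 h12 ht he (harr0 w0.symm (.inr h)) (.inl ha.le)
        · refine false_of_arrival_next_of_pos h2 h12 hsum ht hS hP (harr2 w2.symm (.inr ?_)) ha ge
          rw [← w2] at h
          rw [← w0]
          have hr : r₁ * r₂ ≤ 1 := by nlinarith [sq_nonneg (r₁ - r₂)]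
          have h5 : p 2 * r₁ ≤ p 0 * r₂ * r₁ := mul_le_mul_of_nonneg_right (by linarith) hr1.le
          have h6 : p 0 * (r₁ * r₂) ≤ p 0 * 1 := mul_le_mul_of_nonneg_left hr hpa.le
          linarith
      · exact false_of_arrival_prev h2 h12 ht he (harr0 w0.symm (.inl w2)) (.inl ha.le)
    · have w2 : v 2 = 0 := hend.resolve_left w0.ne'
      exact false_of_arrival_next_of_pos h2 h12 hsum ht hS hP (harr2 w2 (.inl w0)) ha ge
  · rcases (hv 0).eq_or_lt with w0 | w0
    · have w2 : 0 < v 2 := (hv 2).lt_of_ne fun h => by simp [← w0, ← h] at hv02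
      have harr := harr0 w0.symm (.inl w2)
      rcases hz with z | z
      · exact false_of_arrival_prev h2 h12 ht he harr (.inr (hpos0 (by rw [z]; exact hpa)))
      · refine false_of_arrival_prev h2 h12 ht he harr (.inl ?_)
        rw [z, mul_zero, add_zero] at hcost
        exact (pos_of_mul_pos_left (hcost ▸ hC0) (hnn 0)).le
    · have w2 : v 2 = 0 := hend.resolve_left w0.ne'
      have harr := harr2 w2 (.inl w0)
      rcases hz with z | z
      · refine false_of_arrival_next_of_nonneg h2 h12 hsum ht hP harr ?_
          (hpos0 (by rw [z]; exact hpa))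
        rw [z, mul_zero, zero_add] at hcost
        exact (pos_of_mul_pos_left (hcost ▸ hC0) (hnn 2)).le
      · refine false_of_arrival_next_of_pos h2 h12 hsum ht hS hP harr ?_
          (hpos2 (by rw [z]; exact hpb))
        rw [z, mul_zero, add_zero] at hcost
        exact pos_of_mul_pos_left (hcost ▸ hC0) (hnn 0)

/-! ### Optimal chains are gradual -/

/-- A gradual chain to an axis ends with a piece from the origin. If that piece were free, its
increment would be `-s (1,1,1)`; eliminating `s` and `y 2` equates a positive multiple of `v 0` with
minus a nonnegative multiple of `y 1`. -/
lemma GradReach.cost_pos_of_axis_zero (h12 : r₂ < r₁) (hsum : r₁ + r₂ < 2)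
    {v : Fin 3 → ℝ} {C : ℝ} (h : GradReach r₁ r₂ v C) (hv0 : 0 < v 0) (hv1 : v 1 = 0)
    (hv2 : v 2 = 0) : 0 < C := by
  cases h with
  | zero => simp at hv0
  | @step p _ y C hp _ hy hs hsub hne =>
    have hp1 := hsub 1 hv1
    have hp2 := hsub 2 hv2
    have hp0 : p 0 = 0 := by
      obtain ⟨i, hi, hvi⟩ := hne
      fin_cases i
      · exact hi
      · exact absurd hv1 hvi
      · exact absurd hv2 hvi
    have hy0 : y 0 = 0 := (hs 0).resolve_right hv0.ne'
    refine add_pos_of_nonneg_of_pos hp.reach.cost_nonneg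
      ((dispCost_nonneg _).lt_of_ne fun h0 => ?_)
    obtain ⟨s, hs0, hu⟩ := exists_of_dispCost_eq_zero h0.symm
    have u0 := hu 0
    have u1 := hu 1
    have u2 := hu 2
    simp only [Pi.sub_apply, rotR_mulVec_zero, rotR_mulVec_one, rotR_mulVec_two, hp0, hp1, hp2,
      hv1, hv2, hy0] at u0 u1 u2
    have y1 := hy 1
    have y2 := hy 2
    have hr2 : r₂ < 1 := by linarith
    have e1 : (1 - r₁) * y 1 = (1 - r₂) * y 2 := by linarith
    have e2 : 2 * v 0 = (2 * r₂ - 1 - r₁) * y 1 + (2 * r₁ - 1 - r₂) * y 2 := by linarith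
    have e3 : 2 * v 0 * (1 - r₂) =
        -(y 1 * ((1 - r₁) ^ 2 + (1 - r₂) ^ 2 + (r₁ - r₂) ^ 2)) := by
      rw [e2]; linear_combination -(2 * r₁ - 1 - r₂) * e1
    have e4 : 0 ≤ y 1 * ((1 - r₁) ^ 2 + (1 - r₂) ^ 2 + (r₁ - r₂) ^ 2) := by positivity
    have e5 : 0 < 2 * v 0 * (1 - r₂) := mul_pos (by linarith) (by linarith)
    linarith

lemma GradReach.cost_pos_of_axis (h12 : r₂ < r₁) (hsum : r₁ + r₂ < 2)
    {v : Fin 3 → ℝ} {C : ℝ} (h : GradReach r₁ r₂ v C) {k : Fin 3} (hvk : 0 < v k)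
    (hv : ∀ i, i ≠ k → v i = 0) : 0 < C :=
  (h.rotate k).cost_pos_of_axis_zero h12 hsum (by simpa using hvk)
    (hv _ (by simp)) (hv _ (by simp))

/-- If one point of an axis is reached optimally along this axis, then so are all points of all
axes. -/
lemma GradReach.of_axis {p v : Fin 3 → ℝ} {C D : ℝ} (hp : GradReach r₁ r₂ p C)
    (hpopt : ∀ C', Reach r₁ r₂ p C' → C ≤ C') {a b : Fin 3} (hpa : 0 < p a)
    (hp0 : ∀ i, i ≠ a → p i = 0) (hvb : 0 < v b) (hv0 : ∀ i, i ≠ b → v i = 0)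
    (hv : Reach r₁ r₂ v D) (hvopt : ∀ C', Reach r₁ r₂ v C' → D ≤ C') :
    GradReach r₁ r₂ v D := by
  set s := v b / p a with hs
  have hs0 : 0 < s := div_pos hvb hpa
  have hveq : s • cyclicShift (a - b) p = v := by
    ext i
    rcases eq_or_ne i b with rfl | h
    · simp [hs, hpa.ne']
    · simp only [Pi.smul_apply, cyclicShift_apply, hv0 i h, smul_eq_mul]
      rw [hp0, mul_zero]
      intro h'
      exact h (by rw [← sub_eq_zero, ← sub_eq_zero.2 h']; abel)
  have hpeq : s⁻¹ • cyclicShift (-(a - b)) v = p := by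
    rw [← hveq]
    change s⁻¹ • s • cyclicShift (-(a - b)) (cyclicShift (a - b) p) = p
    rw [cyclicShift_neg_cyclicShift, smul_smul, inv_mul_cancel₀ hs0.ne', one_smul]
  have h1 : GradReach r₁ r₂ v (s * C) := hveq ▸ (hp.rotate (a - b)).smul hs0
  have h2 : Reach r₁ r₂ p (s⁻¹ * D) := hpeq ▸ (hv.rotate (-(a - b))).smul (inv_pos.2 hs0)
  have h3 := hvopt _ h1.reach
  have h4 := mul_le_mul_of_nonneg_left (hpopt _ h2) hs0.le
  rw [← mul_assoc, mul_inv_cancel₀ hs0.ne', one_mul] at h4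
  rwa [le_antisymm h3 h4]

lemma Reach.of_rotate {v : Fin 3 → ℝ} {C : ℝ} {k : Fin 3} (h : Reach r₁ r₂ (cyclicShift k v) C) :
    Reach r₁ r₂ v C := by
  simpa [cyclicShift_neg_cyclicShift] using h.rotate (-k)

lemma fin_three_cases {i j k : Fin 3} (hij : i ≠ j) (hik : i ≠ k) (hjk : j ≠ k) (m : Fin 3) :
    m = i ∨ m = j ∨ m = k := by
  revert i j k m; decide

/-- A linear piece that prolongs a gradual chain to an optimal chain can be absorbed. -/
lemma GradReach.extend (h2 : 0 ≤ r₂) (h12 : r₂ < r₁) (hsum : r₁ + r₂ < 2)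
    (hC : 2 * (r₁ * r₂) ^ 2 * (1 + r₁ ^ 2 + r₂ ^ 2 - r₁ - r₂ - r₁ * r₂) ≤
      (1 + r₂ ^ 2) * (1 + r₁ ^ 2 - r₂ - r₁ * r₂) ^ 2)
    {p : Fin 3 → ℝ} {C : ℝ} (hp : GradReach r₁ r₂ p C) :
    ∀ {v y : Fin 3 → ℝ}, (∀ i, 0 ≤ v i) → (∀ i, 0 ≤ y i) → (∀ i, y i = 0 ∨ p i = 0 ∧ v i = 0) →
      (∀ C', Reach r₁ r₂ v C' → C + dispCost (v - p - rotR r₁ r₂ *ᵥ y) ≤ C') →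
      GradReach r₁ r₂ v (C + dispCost (v - p - rotR r₁ r₂ *ᵥ y)) := by
  -- `v` and `y` stay general: merging two pieces invokes the induction hypothesis with the push `y₀
  -- + y`.
  induction hp with
  | zero =>
    intro v y hv hy hs hopt
    by_cases hv0 : v = 0
    · subst hv0
      have := hopt 0 .zero
      have h0 := dispCost_nonneg (0 - 0 - rotR r₁ r₂ *ᵥ y)
      rw [show 0 + dispCost (0 - 0 - rotR r₁ r₂ *ᵥ y) = 0 by linarith]
      exact .zero
    · obtain ⟨i, hi⟩ := Function.ne_iff.1 hv0
      exact .step .zero hv hy (fun i => (hs i).imp_right And.right) (fun _ _ => rfl) ⟨i, rfl, hi⟩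
  | @step p₀ p y₀ C₀ hp₀ hpnn hy₀ hs₀ hsub hne ih =>
    intro v y hv hy hs hopt
    have hpfull := GradReach.step hp₀ hpnn hy₀ hs₀ hsub hne
    by_cases hvp : ∀ i, v i = 0 → p i = 0
    · by_cases hne' : ∃ i, p i = 0 ∧ v i ≠ 0
      · exact .step hpfull hv hy (fun i => (hs i).imp_right And.right) hvp hne'
      · push Not at hne'
        -- the new piece lies in the same face as the last one
        have hle : C₀ + dispCost (v - p₀ - rotR r₁ r₂ *ᵥ (y₀ + y)) ≤
            C₀ + dispCost (p - p₀ - rotR r₁ r₂ *ᵥ y₀) +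
              dispCost (v - p - rotR r₁ r₂ *ᵥ y) := by
          have := dispCost_add_le (p - p₀ - rotR r₁ r₂ *ᵥ y₀) (v - p - rotR r₁ r₂ *ᵥ y)
          rw [show p - p₀ - rotR r₁ r₂ *ᵥ y₀ + (v - p - rotR r₁ r₂ *ᵥ y) =
            v - p₀ - rotR r₁ r₂ *ᵥ (y₀ + y) by rw [Matrix.mulVec_add]; abel] at this
          linarith
        obtain ⟨i, hi, hpi⟩ := hne
        have hg : GradReach r₁ r₂ v (C₀ + dispCost (v - p₀ - rotR r₁ r₂ *ᵥ (y₀ + y))) := by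
          refine .step hp₀ hv (fun i => add_nonneg (hy₀ i) (hy i)) (fun i => ?_)
            (fun i h => hsub i (hvp i h)) ⟨i, hi, fun h => hpi (hvp i h)⟩
          rcases hs i with h | h
          · rcases hs₀ i with h' | h'
            · left; simp [h, h']
            · right; exact hne' i h'
          · exact .inr h.2
        rwa [le_antisymm (hopt _ hg.reach) hle]
    · by_cases hpv : ∀ i, p i = 0 → v i = 0
      · -- the last piece already lies in the face of the new one
        have hsy : ∀ i, (y₀ + y) i = 0 ∨ p₀ i = 0 ∧ v i = 0 := by
          intro i
          rcases hs i with h | h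
          · rcases hs₀ i with h' | h'
            · left; simp [h, h']
            · exact .inr ⟨hsub i h', hpv i h'⟩
          · exact .inr ⟨hsub i h.1, h.2⟩
        have hle : C₀ + dispCost (v - p₀ - rotR r₁ r₂ *ᵥ (y₀ + y)) ≤
            C₀ + dispCost (p - p₀ - rotR r₁ r₂ *ᵥ y₀) +
              dispCost (v - p - rotR r₁ r₂ *ᵥ y) := by
          have := dispCost_add_le (p - p₀ - rotR r₁ r₂ *ᵥ y₀) (v - p - rotR r₁ r₂ *ᵥ y)
          rw [show p - p₀ - rotR r₁ r₂ *ᵥ y₀ + (v - p - rotR r₁ r₂ *ᵥ y) =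
            v - p₀ - rotR r₁ r₂ *ᵥ (y₀ + y) by rw [Matrix.mulVec_add]; abel] at this
          linarith
        have hsn : ∀ i, 0 ≤ (y₀ + y) i := fun i => add_nonneg (hy₀ i) (hy i)
        rw [le_antisymm (hopt _ (hp₀.reach.step hv hsn hsy)) hle]
        exact ih hv hsn hsy fun C' h => hle.trans (hopt C' h)
      -- Neither zero set contains the other: the piece leaves face `i` and lands on face `j`.
      · push Not at hvp hpv
        obtain ⟨i, hpi, hvi⟩ := hpv
        obtain ⟨j, hvj, hpj⟩ := hvp
        have hvi' : 0 < v i := (hv i).lt_of_ne' hvi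
        have hpj' : 0 < p j := (hpnn j).lt_of_ne' hpj
        have hij : i ≠ j := fun h => hvi (h ▸ hvj)
        have hvreach := hpfull.reach.step hv hy hs
        have hpopt : ∀ C', Reach r₁ r₂ p C' →
            C₀ + dispCost (p - p₀ - rotR r₁ r₂ *ᵥ y₀) ≤ C' := fun C' h => by
          have := hopt _ (h.step hv hy hs); linarith
        have hp₀opt : ∀ C', Reach r₁ r₂ p₀ C' → C₀ ≤ C' := fun C' h => by
          have := hpopt _ (h.step hpnn hy₀ fun i => (hs₀ i).imp_right fun h => ⟨hsub i h, h⟩)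
          linarith
        -- Either `p` lies on axis `j`, or it is in the relative interior of the two-dimensional
        -- face `i`. In the latter case the last piece `y₀` can push only coordinate `i`.
        by_cases hpk : ∃ k, k ≠ i ∧ p k = 0
        · obtain ⟨k, hki, hpk⟩ := hpk
          have hjk : j ≠ k := fun h => hpj (h ▸ hpk)
          have hcov := fin_three_cases hij hki.symm hjk
          have hp0 : ∀ m, m ≠ j → p m = 0 := fun m hm => by
            rcases hcov m with rfl | rfl | rfl
            exacts [hpi, absurd rfl hm, hpk]
          by_cases hvk : v k = 0
          · refine GradReach.of_axis hpfull hpopt hpj' hp0 hvi' (fun m hm => ?_) hvreach hopt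
            rcases hcov m with rfl | rfl | rfl
            exacts [absurd rfl hm, hvj, hvk]
          · exfalso
            have hv0 : ∀ m, m ≠ j → 0 < v m := fun m hm => by
              rcases hcov m with rfl | rfl | rfl
              exacts [hvi', absurd rfl hm, (hv _).lt_of_ne' hvk]
            have hy0 : y = 0 := by
              ext m
              rcases hs m with h | h
              · exact h
              · by_contra hc
                rcases eq_or_ne m j with rfl | hm
                · exact hpj h.1
                · exact (hv0 m hm).ne' h.2
            subst hy0
            rw [Matrix.mulVec_zero, sub_zero] at hopt
            refine false_of_axis_crossing (v := cyclicShift j v) h2 h12 (hpfull.reach.rotate j)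
              (by simpa using hpj') (hp0 _ (by simp)) (hp0 _ (by simp)) (by simpa using hvj)
              (hv0 _ (by simp)) (hv0 _ (by simp)) fun C' h => ?_
            rw [show cyclicShift j v - cyclicShift j p = cyclicShift j (v - p) from rfl, dispCost_cyclicShift]
            exact hopt _ h.of_rotate
        · push Not at hpk
          have hp0 : ∀ m, m ≠ i → 0 < p m := fun m hm => (hpnn m).lt_of_ne' (hpk m hm)
          have hy0 : y = 0 := by
            ext m
            rcases hs m with h | h
            · exact h
            · rcases eq_or_ne m i with rfl | hm
              · exact absurd h.2 hvi
              · exact absurd h.1 (hp0 m hm).ne'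
          have hy₀' : y₀ = Pi.single i (y₀ i) := by
            ext m
            rcases eq_or_ne m i with rfl | hm
            · simp
            · simpa [hm] using (hs₀ m).resolve_right (hp0 m hm).ne'
          have hp₀i : p₀ i = 0 := hsub i hpi
          obtain ⟨l, hl, hpl⟩ := hne
          have hli : l ≠ i := fun h => hpl (h ▸ hpi)
          -- If `p₀` is on an axis and `v` on axis `i`, the gradual chain to `p₀` is rotated and
          -- scaled to one for `v`, bypassing `p`.
          by_cases hax : p₀ ≠ 0 ∧ ∀ m, m ≠ i → v m = 0
          · obtain ⟨hne0, hv0⟩ := hax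
            obtain ⟨m, hm⟩ := Function.ne_iff.1 hne0
            have hmi : m ≠ i := fun h => hm (h ▸ hp₀i)
            have hml : m ≠ l := fun h => hm (h ▸ hl)
            refine GradReach.of_axis hp₀ hp₀opt ((hp₀.reach.nonneg m).lt_of_ne' hm)
              (fun m' hm' => ?_) hvi' hv0 hvreach hopt
            rcases fin_three_cases hmi hml hli.symm m' with rfl | rfl | rfl
            exacts [absurd rfl hm', hp₀i, hl]
          · exfalso
            subst hy0
            rw [Matrix.mulVec_zero, sub_zero] at hopt
            -- The shift by `i - 1` moves face `i` to position `1`.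
            have hshift : ∀ m : Fin 3, m + (i - 1) = i ↔ m = 1 := by
              clear * -; revert i; decide
            have hi1 : 1 + (i - 1) = i := (hshift 1).2 rfl
            have hcov : ∀ m, m ≠ i → m = 0 + (i - 1) ∨ m = 2 + (i - 1) := by
              clear * -; revert i; decide
            refine false_of_face_crossing (p₀ := cyclicShift (i - 1) p₀) (p := cyclicShift (i - 1) p)
              (v := cyclicShift (i - 1) v) (η := y₀ i) h2 h12 hsum hC (hp₀.reach.rotate (i - 1))
              (by rw [cyclicShift_apply, hi1, hp₀i]) (by rw [cyclicShift_apply, hi1, hpi])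
              (hp0 _ (by rw [Ne, hshift]; decide)) (hp0 _ (by rw [Ne, hshift]; decide)) (hy₀ i)
              (fun m => hv _) (by rw [cyclicShift_apply, hi1]; exact hvi') (fun C' h => ?_) ?_ ?_
            · have h1 : (y₀ i) • reflCol r₁ r₂ 1 = rotR r₁ r₂ *ᵥ cyclicShift (i - 1) y₀ := by
                rw [← rotR_mulVec_single]
                congr 1
                ext m
                rw [cyclicShift_apply, hy₀']
                simp only [Pi.single_apply, hshift]
                simp
              rw [h1, cyclicShift_increment, dispCost_cyclicShift,
                show cyclicShift (i - 1) v - cyclicShift (i - 1) p =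
                cyclicShift (i - 1) (v - p) from rfl, dispCost_cyclicShift]
              exact hopt _ h.of_rotate
            · by_cases hz : p₀ = 0
              · left; simp [hz]
              · right
                simp only [not_and, ne_eq] at hax
                have hv0 := hax hz
                push Not at hv0
                obtain ⟨n, hni, hvn⟩ := hv0
                refine ⟨?_, ?_, ?_⟩
                · rcases hcov n hni with h | h
                  · left; rw [cyclicShift_apply, ← h]; exact hvn
                  · right; rw [cyclicShift_apply, ← h]; exact hvn
                · obtain ⟨m, hm⟩ := Function.ne_iff.1 hz
                  have hmi : m ≠ i := fun h => hm (h ▸ hp₀i)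
                  have hml : m ≠ l := fun h => hm (h ▸ hl)
                  refine hp₀.cost_pos_of_axis h12 hsum (k := m)
                    ((hp₀.reach.nonneg m).lt_of_ne' hm) fun m' hm' => ?_
                  rcases fin_three_cases hmi hml hli.symm m' with rfl | rfl | rfl
                  exacts [absurd rfl hm', hp₀i, hl]
                · rcases hcov l hli with h | h
                  · left; rw [cyclicShift_apply, ← h]; exact hl
                  · right; rw [cyclicShift_apply, ← h]; exact hl
            · rcases hcov j hij.symm with h | h
              · left; rw [cyclicShift_apply, ← h]; exact hvj
              · right; rw [cyclicShift_apply, ← h]; exact hvj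

/-- A point which is reached optimally by a chain is reached at the same cost by a gradual
chain. -/
theorem Reach.gradReach_of_optimal (h2 : 0 ≤ r₂) (h12 : r₂ < r₁) (hsum : r₁ + r₂ < 2)
    (hC : 2 * (r₁ * r₂) ^ 2 * (1 + r₁ ^ 2 + r₂ ^ 2 - r₁ - r₂ - r₁ * r₂) ≤
      (1 + r₂ ^ 2) * (1 + r₁ ^ 2 - r₂ - r₁ * r₂) ^ 2)
    {v : Fin 3 → ℝ} {C : ℝ} (h : Reach r₁ r₂ v C) :
    (∀ C', Reach r₁ r₂ v C' → C ≤ C') → GradReach r₁ r₂ v C := by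
  induction h with
  | zero => exact fun _ => .zero
  | step _ hv hy hs ih =>
    intro hopt
    refine (ih fun C' h => ?_).extend h2 h12 hsum hC hv hy hs hopt
    have := hopt _ (h.step hv hy hs)
    linarith

/-! ### Piecewise linear regulated paths give chains -/

lemma gammaNormSq_one (w : Fin 3 → ℝ) :
    gammaNormSq 1 w = w 0 ^ 2 + w 1 ^ 2 + w 2 ^ 2 := by
  simp [gammaNormSq, dotProduct, Fin.sum_univ_three, sq]

lemma MemH.component_absCont {d : ℕ} {x : OrthantPath d} (hx : MemH x) (i : Fin d) {s t : ℝ}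
    (hs : 0 ≤ s) (ht : 0 ≤ t) : AbsolutelyContinuousOnInterval (fun t => x t i) s t := by
  have hT := hx.absCont (max s t) (hs.trans (le_max_left _ _))
  have h : AbsolutelyContinuousOnInterval (fun t => x t i) 0 (max s t) := by
    rw [absolutelyContinuousOnInterval_iff] at hT ⊢
    intro ε hε
    obtain ⟨δ, hδ, H⟩ := hT ε hε
    exact ⟨δ, hδ, fun E hE hE' =>
      (Finset.sum_le_sum fun k _ => dist_le_pi_dist _ _ i).trans_lt (H E hE hE')⟩
  refine h.mono ?_
  rw [uIcc_of_le (hs.trans (le_max_left _ _))]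
  exact uIcc_subset_Icc ⟨hs, le_max_left _ _⟩ ⟨ht, le_max_right _ _⟩

lemma MemH.ae_deriv_apply {d : ℕ} {x : OrthantPath d} (hx : MemH x) {s t : ℝ}
    (hs : 0 ≤ s) (ht : 0 ≤ t) :
    ∀ᵐ r, r ∈ uIcc s t → ∀ i, deriv x r i = deriv (fun t => x t i) r := by
  have : ∀ᵐ r, ∀ i, r ∈ uIcc s t → DifferentiableAt ℝ (fun t => x t i) r :=
    ae_all_iff.2 fun i => (hx.component_absCont i hs ht).ae_differentiableAt
  filter_upwards [this] with r hr hmem i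
  rw [show deriv x r = fun i => deriv (fun t => x t i) r from deriv_pi fun i => hr i hmem]

lemma MemH.intervalIntegrable_deriv {d : ℕ} {x : OrthantPath d} (hx : MemH x) (i : Fin d)
    {s t : ℝ} (hs : 0 ≤ s) (ht : 0 ≤ t) :
    IntervalIntegrable (fun r => deriv x r i) volume s t := by
  refine (hx.component_absCont i hs ht).intervalIntegrable_deriv.congr_ae ?_
  rw [Filter.EventuallyEq, ae_restrict_iff' measurableSet_uIoc]
  filter_upwards [hx.ae_deriv_apply hs ht] with r hr hmem
  exact (hr (uIoc_subset_uIcc hmem) i).symm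

lemma MemH.integral_deriv {d : ℕ} {x : OrthantPath d} (hx : MemH x) (i : Fin d)
    {s t : ℝ} (hs : 0 ≤ s) (ht : 0 ≤ t) :
    ∫ r in s..t, deriv x r i = x t i - x s i := by
  rw [← (hx.component_absCont i hs ht).integral_deriv_eq_sub]
  refine intervalIntegral.integral_congr_ae ?_
  filter_upwards [hx.ae_deriv_apply hs ht] with r hr hmem
  exact hr (uIoc_subset_uIcc hmem) i

lemma MemH.intervalIntegrable_sq {d : ℕ} {x : OrthantPath d} (hx : MemH x) (i : Fin d)
    {s t : ℝ} (hs : 0 ≤ s) (ht : 0 ≤ t) :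
    IntervalIntegrable (fun r => deriv x r i ^ 2) volume s t :=
  (hx.sqIntegrable s hs i).symm.trans (hx.sqIntegrable t ht i)

lemma MemH.intervalIntegrable_cost {x : OrthantPath 3} (hx : MemH x) (θ : Fin 3 → ℝ)
    {s t : ℝ} (hs : 0 ≤ s) (ht : 0 ≤ t) :
    IntervalIntegrable (fun r => gammaNormSq 1 (deriv x r - θ)) volume s t := by
  have h : ∀ i, IntervalIntegrable (fun r => (deriv x r - θ) i ^ 2) volume s t := by
    intro i
    refine (((hx.intervalIntegrable_sq i hs ht).sub
      ((hx.intervalIntegrable_deriv i hs ht).const_mul (2 * θ i))).add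
        (intervalIntegrable_const (c := θ i ^ 2))).congr ?_
    intro r _
    simp only [Pi.sub_apply]; ring
  simp only [gammaNormSq_one]
  exact ((h 0).add (h 1)).add (h 2)

/-- The gap is `½ ‖w + θ₀ (ξ - 1)‖²` with `ξ = costGrad u` on the sphere: a linear minorant of the
running cost, integrated in `MemH.neg_mul_dispCost_le`. -/
lemma neg_mul_costGrad_dotProduct_le {θ₀ : ℝ} {u : Fin 3 → ℝ} (hu : 0 < euclNorm u)
    (w : Fin 3 → ℝ) :
    -θ₀ * (costGrad u ⬝ᵥ w) ≤ 1 / 2 * gammaNormSq 1 (w - rotDrift θ₀) := by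
  have h := costGrad_sphere hu
  rw [gammaNormSq_one]
  simp only [dotProduct, Fin.sum_univ_three, rotDrift, Pi.sub_apply]
  set a := costGrad u 0
  set b := costGrad u 1
  set c := costGrad u 2
  have e : 1 / 2 * ((w 0 - θ₀) ^ 2 + (w 1 - θ₀) ^ 2 + (w 2 - θ₀) ^ 2) -
      -θ₀ * (a * w 0 + b * w 1 + c * w 2) = 1 / 2 * ((w 0 + θ₀ * (a - 1)) ^ 2 +
        (w 1 + θ₀ * (b - 1)) ^ 2 + (w 2 + θ₀ * (c - 1)) ^ 2) := by
    linear_combination -(1 / 2) * θ₀ ^ 2 * h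
  have : 0 ≤ 1 / 2 * ((w 0 + θ₀ * (a - 1)) ^ 2 +
        (w 1 + θ₀ * (b - 1)) ^ 2 + (w 2 + θ₀ * (c - 1)) ^ 2) := by positivity
  linarith

lemma gammaNormSq_one_nonneg (w : Fin 3 → ℝ) : 0 ≤ gammaNormSq 1 w := by
  rw [gammaNormSq_one]; positivity

lemma MemH.neg_mul_dispCost_le {x : OrthantPath 3} (hx : MemH x) {θ₀ s t : ℝ}
    (hs : 0 ≤ s) (hst : s ≤ t) :
    -θ₀ * dispCost (x t - x s) ≤
      1 / 2 * ∫ r in s..t, gammaNormSq 1 (deriv x r - rotDrift θ₀) := by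
  by_cases hu : x t - x s = 0
  · rw [hu, dispCost_zero, mul_zero]
    exact mul_nonneg (by norm_num)
      (intervalIntegral.integral_nonneg hst fun _ _ => gammaNormSq_one_nonneg _)
  · have hn := euclNorm_pos hu
    have ht := hs.trans hst
    have hi := fun i => (hx.intervalIntegrable_deriv i hs ht).const_mul (costGrad (x t - x s) i)
    have e : dispCost (x t - x s) = ∫ r in s..t, costGrad (x t - x s) ⬝ᵥ deriv x r := by
      rw [← costGrad_dotProduct_self hn]
      simp only [dotProduct, Fin.sum_univ_three]
      rw [intervalIntegral.integral_add ((hi 0).add (hi 1)) (hi 2),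
        intervalIntegral.integral_add (hi 0) (hi 1)]
      simp only [intervalIntegral.integral_const_mul, hx.integral_deriv _ hs ht, Pi.sub_apply]
    rw [e, ← intervalIntegral.integral_const_mul, ← intervalIntegral.integral_const_mul]
    refine intervalIntegral.integral_mono_on hst ?_ ?_ fun r _ =>
      neg_mul_costGrad_dotProduct_le hn _
    · refine IntervalIntegrable.const_mul ?_ _
      simp only [dotProduct, Fin.sum_univ_three]
      exact ((hi 0).add (hi 1)).add (hi 2)
    · exact (hx.intervalIntegrable_cost _ hs ht).const_mul _

/-- The regulating process of a coordinate is constant on an interval inside which this coordinate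
is positive. -/
lemma IsRegulation.eq_of_pos {d : ℕ} {R : Matrix (Fin d) (Fin d) ℝ} {x y z : OrthantPath d}
    (h : IsRegulation R x y z) {s t : ℝ} (hs : 0 ≤ s) (hst : s < t) (i : Fin d)
    (hpos : ∀ r ∈ Ioo s t, 0 < z r i) : y t i = y s i := by
  set f := stieltjesOfPath (fun t => y t i) (h.y_mono i) (h.y_cont i) with hf
  have hmeas : f.measure (Ioo s t) = 0 := by
    have h0 := h.compl i
    have hzi : ContinuousOn (fun t => z t i) (Ici 0) :=
      (continuous_apply i).comp_continuousOn h.z_cont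
    have hz : AEMeasurable (fun t => ENNReal.ofReal (z t i)) (f.measure.restrict (Ici 0)) :=
      (hzi.aemeasurable measurableSet_Ici).ennreal_ofReal
    rw [lintegral_eq_zero_iff' hz, Filter.EventuallyEq, ae_restrict_iff' measurableSet_Ici] at h0
    refine measure_mono_null (fun r hr => ?_) h0
    rw [mem_compl_iff, mem_ofPred_eq]
    intro hc
    have := hc (show r ∈ Ici (0 : ℝ) from hs.trans hr.1.le)
    simp only [Pi.zero_apply, ENNReal.ofReal_eq_zero] at this
    exact absurd (hpos r hr) (not_lt.2 this)
  have hcont : Continuous f :=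
    (h.y_cont i).comp_continuous (continuous_id.max continuous_const)
      (fun s => (le_max_right s 0 : (0 : ℝ) ≤ max s 0))
  rw [StieltjesFunction.measure_Ioo, hcont.continuousAt.continuousWithinAt.leftLim_eq,
    ENNReal.ofReal_eq_zero, sub_nonpos] at hmeas
  have e : ∀ r, 0 ≤ r → f r = y r i := fun r hr => by
    change y (max r 0) i = y r i
    rw [max_eq_left hr]
  rw [e s hs, e t (hs.trans hst.le)] at hmeas
  exact le_antisymm hmeas (h.y_mono i hs (hs.trans hst.le) hst.le)

/-- A nonnegative affine coordinate that does not vanish at both ends is positive strictly inside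
the interval, so it is not pushed there. -/
lemma IsRegulation.eq_or_of_affine {d : ℕ} {R : Matrix (Fin d) (Fin d) ℝ} {x y z : OrthantPath d}
    (h : IsRegulation R x y z) {s t : ℝ} (hs : 0 ≤ s) (hst : s < t) {a b : Fin d → ℝ}
    (hz : ∀ r ∈ Icc s t, z r = a + r • b) (i : Fin d) :
    (y t - y s) i = 0 ∨ z s i = 0 ∧ z t i = 0 := by
  by_cases h0 : z s i = 0 ∧ z t i = 0
  · exact .inr h0
  left
  rw [Pi.sub_apply, sub_eq_zero]
  have hzi : ∀ r ∈ Icc s t, z r i = a i + r * b i := fun r hr => by rw [hz r hr]; simp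
  have es := hzi s ⟨le_rfl, hst.le⟩
  have et := hzi t ⟨hst.le, le_rfl⟩
  have ns := h.z_nonneg s hs i
  have nt := h.z_nonneg t (hs.trans hst.le) i
  refine h.eq_of_pos hs hst i fun r hr => ?_
  have er := hzi r ⟨hr.1.le, hr.2.le⟩
  have e : (t - s) * z r i = (t - r) * z s i + (r - s) * z t i := by rw [es, et, er]; ring
  have h1 : 0 < t - r := sub_pos.2 hr.2
  have h2 : 0 < r - s := sub_pos.2 hr.1
  have h3 : 0 < (t - s) * z r i := by
    rw [e]
    rcases ns.eq_or_lt with h | h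
    · have : 0 < z t i := nt.lt_of_ne fun h' => h0 ⟨h.symm, h'.symm⟩
      rw [← h, mul_zero, zero_add]; positivity
    · positivity
  exact pos_of_mul_pos_right h3 (by linarith)

/-- A regulated path with finitely many linear pieces yields a chain which is at most as
expensive. -/
lemma exists_reach_of_hasPieces {θ₀ : ℝ} {x y z : OrthantPath 3}
    (hx : MemH x) (h : IsRegulation (rotR r₁ r₂) x y z) {T : ℝ} {n : ℕ} {τ : Fin (n + 1) → ℝ}
    (hz : HasPieces z T n τ) :
    ∃ C, Reach r₁ r₂ (z T) C ∧ -θ₀ * C ≤ pathCost (rotDrift θ₀) 1 x T := by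
  obtain ⟨hmono, h0, hT, haff⟩ := hz
  have hτ : ∀ k, 0 ≤ τ k := fun k => h0 ▸ hmono.monotone (Fin.zero_le k)
  have key : ∀ k, ∃ C, Reach r₁ r₂ (z (τ k)) C ∧
      -θ₀ * C ≤ pathCost (rotDrift θ₀) 1 x (τ k) := by
    intro k
    induction k using Fin.induction with
    | zero =>
      have hz0 : z 0 = 0 := by
        rw [h.eq 0 le_rfl, hx.zero, h.y_zero, Matrix.mulVec_zero, add_zero]
      refine ⟨0, by rw [h0, hz0]; exact .zero, ?_⟩
      simp [h0, pathCost]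
    | succ k ih =>
      obtain ⟨C, hC, hle⟩ := ih
      have hlt : τ k.castSucc < τ k.succ := hmono k.castSucc_lt_succ
      set s := τ k.castSucc
      set t := τ k.succ
      have hs : 0 ≤ s := hτ _
      have ht : 0 ≤ t := hτ _
      obtain ⟨a, b, hab⟩ := haff k
      have hstep := hC.step (v := z t) (y := y t - y s) (h.z_nonneg t ht)
        (fun i => sub_nonneg.2 (h.y_mono i hs ht hlt.le))
        (fun i => h.eq_or_of_affine hs hlt hab i)
      refine ⟨_, hstep, ?_⟩
      have e : z t - z s - rotR r₁ r₂ *ᵥ (y t - y s) = x t - x s := by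
        rw [h.eq t ht, h.eq s hs, Matrix.mulVec_sub]; abel
      rw [e, mul_add]
      have h1 := hx.neg_mul_dispCost_le (θ₀ := θ₀) hs hlt.le
      have h2 := intervalIntegral.integral_add_adjacent_intervals
        (hx.intervalIntegrable_cost (rotDrift θ₀) le_rfl hs)
        (hx.intervalIntegrable_cost (rotDrift θ₀) hs ht)
      simp only [pathCost] at hle ⊢
      rw [← h2]; linarith
  rw [← hT]
  exact key _

/-! ### Chains are realized by piecewise linear regulated paths -/

/-- The function which is `0` up to time `T`, `1` from time `T + σ` on, and linear in between. -/
def ramp (T σ t : ℝ) : ℝ := max 0 (min 1 ((t - T) / σ))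

lemma ramp_nonneg (T σ t : ℝ) : 0 ≤ ramp T σ t := le_max_left _ _

lemma ramp_le_one (T σ t : ℝ) : ramp T σ t ≤ 1 := max_le zero_le_one (min_le_left _ _)

lemma ramp_of_le {T σ t : ℝ} (hσ : 0 < σ) (ht : t ≤ T) : ramp T σ t = 0 :=
  max_eq_left ((min_le_right _ _).trans (div_nonpos_of_nonpos_of_nonneg (by linarith) hσ.le))

lemma ramp_of_ge {T σ t : ℝ} (hσ : 0 < σ) (ht : T + σ ≤ t) : ramp T σ t = 1 := by
  rw [ramp, min_eq_left, max_eq_right zero_le_one]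
  rw [le_div_iff₀ hσ]; linarith

lemma ramp_of_mem {T σ t : ℝ} (hσ : 0 < σ) (ht : t ∈ Icc T (T + σ)) :
    ramp T σ t = (t - T) / σ := by
  have h1 : (t - T) / σ ≤ 1 := by rw [div_le_iff₀ hσ]; linarith [ht.2]
  have h0 : 0 ≤ (t - T) / σ := div_nonneg (by linarith [ht.1]) hσ.le
  rw [ramp, min_eq_right h1, max_eq_right h0]

lemma ramp_monotone {T σ : ℝ} (hσ : 0 < σ) : Monotone (ramp T σ) := fun s t h =>
  max_le_max_left _ (min_le_min_left _ (div_le_div_of_nonneg_right (by linarith) hσ.le))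

lemma lipschitzWith_ramp (T σ : ℝ) : LipschitzWith (Real.toNNReal |σ⁻¹|) (ramp T σ) := by
  have h : LipschitzWith (Real.toNNReal |σ⁻¹|) fun t => (t - T) / σ :=
    LipschitzWith.of_dist_le_mul fun s t => by
      rw [Real.coe_toNNReal _ (abs_nonneg _), Real.dist_eq, Real.dist_eq, ← abs_mul]
      exact le_of_eq (by congr 1; ring)
  exact (h.const_min 1).const_max 0

lemma continuous_ramp (T σ : ℝ) : Continuous (ramp T σ) := (lipschitzWith_ramp T σ).continuous

lemma LipschitzWith.memH {d : ℕ} {x : OrthantPath d} {K : NNReal} (h : LipschitzWith K x)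
    (h0 : x 0 = 0) : MemH x where
  absCont _ _ := h.lipschitzOnWith.absolutelyContinuousOnInterval
  zero := h0
  sqIntegrable T _ i := by
    have hm : Measurable fun t => deriv x t i := (measurable_pi_apply i).comp (measurable_deriv x)
    rw [intervalIntegrable_iff]
    refine Measure.integrableOn_of_bounded (M := (K : ℝ) ^ 2) ?_ (hm.pow_const 2).aestronglyMeasurable
      (Filter.Eventually.of_forall fun t => ?_)
    · simp [uIoc]
    · rw [norm_pow]
      exact pow_le_pow_left₀ (norm_nonneg _)
        ((norm_le_pi_norm _ i).trans (norm_deriv_le_of_lipschitz h)) 2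

/-- A Lipschitz triple that reaches `v` at time `T` at cost `|θ₀| C` and then stops. -/
structure IsRealization (θ₀ r₁ r₂ : ℝ) (v : Fin 3 → ℝ) (C : ℝ) (x y z : OrthantPath 3) (T : ℝ) :
    Prop where
  time_nonneg : 0 ≤ T
  reg : IsRegulation (rotR r₁ r₂) x y z
  lipschitz : ∃ K, LipschitzWith K x
  x_zero : x 0 = 0
  x_const : ∀ t, T ≤ t → x t = x T
  y_const : ∀ t, T ≤ t → y t = y T
  z_eq : ∀ t, T ≤ t → z t = v
  cost : pathCost (rotDrift θ₀) 1 x T = -θ₀ * C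

lemma IsRealization.memH {θ₀ : ℝ} {v : Fin 3 → ℝ} {C T : ℝ} {x y z : OrthantPath 3}
    (h : IsRealization θ₀ r₁ r₂ v C x y z T) : MemH x :=
  let ⟨_, hK⟩ := h.lipschitz
  hK.memH h.x_zero

lemma IsRealization.isFeasible {θ₀ : ℝ} {v : Fin 3 → ℝ} {C T : ℝ} {x y z : OrthantPath 3}
    (h : IsRealization θ₀ r₁ r₂ v C x y z T) : IsFeasible (rotR r₁ r₂) v x y z T :=
  ⟨h.time_nonneg, h.memH, h.reg, h.z_eq T le_rfl⟩

lemma stieltjesOfPath_apply {f : ℝ → ℝ} (hm : MonotoneOn f (Ici 0)) (hc : ContinuousOn f (Ici 0))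
    {t : ℝ} (ht : 0 ≤ t) : stieltjesOfPath f hm hc t = f t := by
  change f (max t 0) = f t
  rw [max_eq_left ht]

lemma stieltjesOfPath_measure_Ioi {f : ℝ → ℝ} (hm : MonotoneOn f (Ici 0))
    (hc : ContinuousOn f (Ici 0)) {T : ℝ} (hT : 0 ≤ T) (h : ∀ t, T ≤ t → f t = f T) :
    (stieltjesOfPath f hm hc).measure (Ioi T) = 0 := by
  have hlim : Filter.Tendsto (stieltjesOfPath f hm hc) Filter.atTop (nhds (f T)) := by
    refine tendsto_const_nhds.congr' ?_
    filter_upwards [Filter.eventually_ge_atTop T] with t ht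
    rw [stieltjesOfPath_apply _ _ (hT.trans ht), h t ht]
  rw [StieltjesFunction.measure_Ioi _ hlim, stieltjesOfPath_apply _ _ hT]
  simp

lemma stieltjesOfPath_measure_Iic {f : ℝ → ℝ} (hm : MonotoneOn f (Ici 0))
    (hc : ContinuousOn f (Ici 0)) {T : ℝ} (hT : 0 ≤ T) (h : ∀ t, t ≤ T → f t = 0) :
    (stieltjesOfPath f hm hc).measure (Iic T) = 0 := by
  have hz : ∀ t, t ≤ T → stieltjesOfPath f hm hc t = 0 := fun t ht => h _ (max_le ht hT)
  have hlim : Filter.Tendsto (stieltjesOfPath f hm hc) Filter.atBot (nhds 0) := by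
    refine tendsto_const_nhds.congr' ?_
    filter_upwards [Filter.eventually_le_atBot T] with t ht
    rw [hz t ht]
  rw [StieltjesFunction.measure_Iic _ hlim, hz T le_rfl]
  simp

/-- A realization can be prolonged by a linear piece. -/
lemma IsRealization.exists_extend {θ₀ : ℝ} (hθ : θ₀ < 0) {p : Fin 3 → ℝ} {C T : ℝ}
    {x y z : OrthantPath 3} (h : IsRealization θ₀ r₁ r₂ p C x y z T) {v η : Fin 3 → ℝ}
    (hv : ∀ i, 0 ≤ v i) (hη : ∀ i, 0 ≤ η i) (hs : ∀ i, η i = 0 ∨ p i = 0 ∧ v i = 0)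
    (hu : v - p - rotR r₁ r₂ *ᵥ η ≠ 0) :
    ∃ x' y' z' T', IsRealization θ₀ r₁ r₂ v (C + dispCost (v - p - rotR r₁ r₂ *ᵥ η)) x' y' z' T' ∧
      T < T' ∧ (∀ t, t ≤ T → z' t = z t) ∧
      ∃ a b : Fin 3 → ℝ, ∀ t ∈ Icc T T', z' t = a + t • b := by
  set u := v - p - rotR r₁ r₂ *ᵥ η with hud
  have hn := euclNorm_pos hu
  have h3 : 0 < √3 := by positivity
  have hq : 0 < -θ₀ := neg_pos.2 hθ
  -- The optimal duration: the driving path moves at speed `‖θ‖ = √3 |θ₀|`.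
  set σ := euclNorm u / (√3 * -θ₀) with hσd
  have hσ : 0 < σ := by positivity
  have hT := h.time_nonneg
  have hp : ∀ i, 0 ≤ p i := fun i => by rw [← h.z_eq T le_rfl]; exact h.reg.z_nonneg T hT i
  obtain ⟨K, hK⟩ := h.lipschitz
  have hφ := continuous_ramp T σ
  have hlip : ∃ K', LipschitzWith K' fun t => x t + ramp T σ t • u := by
    have : LipschitzWith (Real.toNNReal |σ⁻¹| * ‖u‖₊) fun t => ramp T σ t • u :=
      LipschitzWith.of_dist_le_mul fun s t => by
        rw [dist_eq_norm, ← sub_smul, norm_smul, NNReal.coe_mul, coe_nnnorm, mul_right_comm]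
        refine mul_le_mul_of_nonneg_right ?_ (norm_nonneg _)
        rw [← dist_eq_norm]
        exact (lipschitzWith_ramp T σ).dist_le_mul s t
    exact ⟨_, hK.add this⟩
  have hx0 : x 0 + ramp T σ 0 • u = 0 := by rw [ramp_of_le hσ hT, h.x_zero]; simp
  have hmem : MemH fun t => x t + ramp T σ t • u := let ⟨_, hK'⟩ := hlip; hK'.memH hx0
  have hmono : ∀ i, MonotoneOn (fun t => ramp T σ t * η i) (Ici 0) := fun i s _ t _ hst =>
    mul_le_mul_of_nonneg_right (ramp_monotone hσ hst) (hη i)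
  have hcont : ∀ i, ContinuousOn (fun t => ramp T σ t * η i) (Ici 0) := fun i =>
    (hφ.mul continuous_const).continuousOn
  refine ⟨fun t => x t + ramp T σ t • u, fun t => y t + ramp T σ t • η,
    fun t => z t + ramp T σ t • (v - p), T + σ, ⟨by linarith, ⟨?_, ?_, ?_, ?_, ?_, ?_, ?_, ?_⟩,
      hlip, hx0, ?_, ?_, ?_, ?_⟩, by linarith, ?_, ?_⟩
  · exact h.reg.x_cont.add (hφ.smul continuous_const).continuousOn
  · intro i
    exact (h.reg.y_cont i).add (hcont i)
  · exact h.reg.z_cont.add (hφ.smul continuous_const).continuousOn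
  · intro t ht
    rw [h.reg.eq t ht, Matrix.mulVec_add, Matrix.mulVec_smul, hud]
    module
  · intro t ht i
    rcases le_total t T with h' | h'
    · simpa [ramp_of_le hσ h'] using h.reg.z_nonneg t ht i
    · rw [h.z_eq t h']
      have a := mul_nonneg (sub_nonneg.2 (ramp_le_one T σ t)) (hp i)
      have b := mul_nonneg (ramp_nonneg T σ t) (hv i)
      simp only [Pi.add_apply, Pi.smul_apply, Pi.sub_apply, smul_eq_mul]
      linarith
  · intro i
    exact (h.reg.y_mono i).add (hmono i)
  · rw [ramp_of_le hσ hT, h.reg.y_zero]; simp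
  · intro i
    set f := stieltjesOfPath (fun t => y t i) (h.reg.y_mono i) (h.reg.y_cont i) with hf
    set g := stieltjesOfPath _ (hmono i) (hcont i) with hg
    have hfg : stieltjesOfPath (fun t => (y t + ramp T σ t • η) i)
        ((h.reg.y_mono i).add (hmono i)) ((h.reg.y_cont i).add (hcont i)) = f + g := by
      ext t; rfl
    rw [hfg, StieltjesFunction.measure_add, Measure.restrict_add, lintegral_add_measure,
      add_eq_zero]
    -- The old push does not charge times after `T`, up to which `z` is unchanged; the new push
    -- charges only times after `T`, when a pushed coordinate stays at `0`.
    constructor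
    · rw [← h.reg.compl i]
      have hnull : f.measure (Ioi T) = 0 :=
        stieltjesOfPath_measure_Ioi _ _ hT fun t ht => by rw [h.y_const t ht]
      refine lintegral_congr_ae (ae_restrict_of_ae ?_)
      have : ∀ᵐ t ∂f.measure, t ∉ Ioi T := measure_eq_zero_iff_ae_notMem.1 hnull
      filter_upwards [this] with t ht
      rw [ramp_of_le hσ (not_lt.1 ht)]; simp
    · rcases hs i with h0 | ⟨h0, h1⟩
      · have hg0 : g = StieltjesFunction.const ℝ 0 := by
          ext t
          change ramp T σ (max t 0) * η i = 0
          rw [h0, mul_zero]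
        rw [hg0, StieltjesFunction.measure_const]; simp
      · have hnull : g.measure (Iic T) = 0 :=
          stieltjesOfPath_measure_Iic _ _ hT fun t ht => by rw [ramp_of_le hσ ht, zero_mul]
        rw [← lintegral_zero (μ := g.measure.restrict (Ici 0))]
        refine lintegral_congr_ae (ae_restrict_of_ae ?_)
        have : ∀ᵐ t ∂g.measure, t ∉ Iic T := measure_eq_zero_iff_ae_notMem.1 hnull
        filter_upwards [this] with t ht
        simp [h.z_eq t (not_le.1 ht).le, h0, h1]
  · intro t ht
    simp only [ramp_of_ge hσ ht, ramp_of_ge hσ le_rfl, h.x_const t (by linarith),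
      h.x_const (T + σ) (by linarith)]
  · intro t ht
    simp only [ramp_of_ge hσ ht, ramp_of_ge hσ le_rfl, h.y_const t (by linarith),
      h.y_const (T + σ) (by linarith)]
  · intro t ht
    simp only [ramp_of_ge hσ ht, h.z_eq t (by linarith), one_smul, add_sub_cancel]
  · have hTσ : 0 ≤ T + σ := by linarith
    rw [mul_add, ← h.cost]
    simp only [pathCost]
    rw [← intervalIntegral.integral_add_adjacent_intervals
        (hmem.intervalIntegrable_cost (rotDrift θ₀) le_rfl hT)
        (hmem.intervalIntegrable_cost (rotDrift θ₀) hT hTσ), mul_add]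
    congr 1
    · congr 1
      refine intervalIntegral.integral_congr_ae ?_
      filter_upwards [compl_mem_ae_iff.2 (measure_singleton T)] with t htT ht
      rw [uIoc_of_le hT] at ht
      have : t < T := lt_of_le_of_ne ht.2 htT
      have heq : (fun t => x t + ramp T σ t • u) =ᶠ[nhds t] x := by
        filter_upwards [Iio_mem_nhds this] with s hs
        rw [ramp_of_le hσ (le_of_lt hs)]; simp
      rw [heq.deriv_eq]
    · have hconst : ∫ t in T..T + σ, gammaNormSq 1
          (deriv (fun t => x t + ramp T σ t • u) t - rotDrift θ₀) =
          ∫ _ in T..T + σ, gammaNormSq 1 (σ⁻¹ • u - rotDrift θ₀) := by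
        refine intervalIntegral.integral_congr_ae ?_
        filter_upwards [compl_mem_ae_iff.2 (measure_singleton (T + σ))] with t htT ht
        rw [uIoc_of_le (by linarith)] at ht
        have htlt : t < T + σ := lt_of_le_of_ne ht.2 htT
        have heq : (fun t => x t + ramp T σ t • u) =ᶠ[nhds t]
            fun s => x T + ((s - T) / σ) • u := by
          filter_upwards [Ioo_mem_nhds ht.1 htlt] with s hs
          rw [ramp_of_mem hσ ⟨hs.1.le, hs.2.le⟩, h.x_const s hs.1.le]
        have hd : HasDerivAt (fun s => x T + ((s - T) / σ) • u) (σ⁻¹ • u) t := by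
          have h1 : HasDerivAt (fun s => (s - T) / σ) σ⁻¹ t := by
            simpa using ((hasDerivAt_id t).sub_const T).div_const σ
          exact (h1.smul_const u).const_add _
        rw [heq.deriv_eq, hd.deriv]
      rw [hconst, intervalIntegral.integral_const, gammaNormSq_one, dispCost]
      have hsq := euclNorm_sq u
      have h33 : √3 ^ 2 = 3 := Real.sq_sqrt (by norm_num)
      simp only [add_sub_cancel_left, Pi.sub_apply, Pi.smul_apply, smul_eq_mul, rotDrift]
      have e : σ * ((σ⁻¹ * u 0 - θ₀) ^ 2 + (σ⁻¹ * u 1 - θ₀) ^ 2 + (σ⁻¹ * u 2 - θ₀) ^ 2) =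
          σ⁻¹ * euclNorm u ^ 2 - 2 * θ₀ * (u 0 + u 1 + u 2) + √3 ^ 2 * θ₀ ^ 2 * σ := by
        rw [hsq, h33]; field_simp; ring
      rw [e, hσd]
      field_simp
      ring
  · intro t ht
    simp only [ramp_of_le hσ ht, zero_smul, add_zero]
  · refine ⟨p - (T / σ) • (v - p), σ⁻¹ • (v - p), fun t ht => ?_⟩
    simp only [h.z_eq t ht.1, ramp_of_mem hσ ht]
    module

/-- Such a piece would take no time and must be dropped. As `R` has unit diagonal and nonnegative
entries, `y ≤ R y`, while a pushed coordinate has `(R y) i = 0`; so nothing is pushed. -/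
lemma eq_of_increment_eq_zero (h1 : 0 ≤ r₁) (h2 : 0 ≤ r₂) {v p y : Fin 3 → ℝ}
    (hy : ∀ i, 0 ≤ y i) (hs : ∀ i, y i = 0 ∨ p i = 0 ∧ v i = 0)
    (hu : v - p - rotR r₁ r₂ *ᵥ y = 0) : v = p := by
  have hle : ∀ i, y i ≤ (rotR r₁ r₂ *ᵥ y) i := by
    have a0 := hy 0
    have a1 := hy 1
    have a2 := hy 2
    intro i
    fin_cases i
    · have : 0 ≤ r₂ * y 1 + r₁ * y 2 := by positivity
      simp only [Fin.zero_eta, rotR_mulVec_zero]; linarith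
    · have : 0 ≤ r₁ * y 0 + r₂ * y 2 := by positivity
      simp only [Fin.mk_one, rotR_mulVec_one]; linarith
    · have : 0 ≤ r₂ * y 0 + r₁ * y 1 := by positivity
      simp only [Fin.reduceFinMk, rotR_mulVec_two]; linarith
  have hy0 : y = 0 := by
    ext i
    rcases hs i with h | ⟨hp, hv⟩
    · exact h
    · have := congrFun hu i
      simp only [Pi.sub_apply, hp, hv, Pi.zero_apply] at this
      have hi := hle i
      exact le_antisymm (by rw [Pi.zero_apply]; linarith) (hy i)
  rw [hy0, Matrix.mulVec_zero, sub_zero, sub_eq_zero] at hu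
  exact hu

lemma isRealization_zero (θ₀ r₁ r₂ : ℝ) : IsRealization θ₀ r₁ r₂ 0 0 0 0 0 0 where
  time_nonneg := le_rfl
  reg :=
    { x_cont := continuousOn_const
      y_cont := fun _ => continuousOn_const
      z_cont := continuousOn_const
      eq := fun _ _ => by simp
      z_nonneg := fun _ _ _ => le_rfl
      y_mono := fun _ _ _ _ _ _ => le_rfl
      y_zero := rfl
      compl := fun _ => by simp }
  lipschitz := ⟨0, LipschitzWith.const 0⟩
  x_zero := rfl
  x_const _ _ := rfl
  y_const _ _ := rfl
  z_eq _ _ := rfl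
  cost := by simp [pathCost]

lemma Reach.exists_isRealization (h1 : 0 ≤ r₁) (h2 : 0 ≤ r₂) {θ₀ : ℝ} (hθ : θ₀ < 0)
    {v : Fin 3 → ℝ} {C : ℝ} (h : Reach r₁ r₂ v C) :
    ∃ x y z T, IsRealization θ₀ r₁ r₂ v C x y z T := by
  induction h with
  | zero => exact ⟨_, _, _, _, isRealization_zero θ₀ r₁ r₂⟩
  | @step p v y C _ hv hy hs ih =>
    obtain ⟨x, η, z, T, hr⟩ := ih
    by_cases hu : v - p - rotR r₁ r₂ *ᵥ y = 0
    · rw [hu, dispCost_zero, add_zero, eq_of_increment_eq_zero h1 h2 hy hs hu]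
      exact ⟨x, η, z, T, hr⟩
    · obtain ⟨x', y', z', T', hr', -⟩ := hr.exists_extend hθ hv hy hs hu
      exact ⟨x', y', z', T', hr'⟩

/-! ### Gradual chains give gradual paths -/

open Classical in
/-- The set of vanishing coordinates. -/
def zeroSet (v : Fin 3 → ℝ) : Finset (Fin 3) := Finset.univ.filter fun i => v i = 0

@[simp] lemma mem_zeroSet {v : Fin 3 → ℝ} {i : Fin 3} : i ∈ zeroSet v ↔ v i = 0 := by
  simp [zeroSet]

/-- The final bound on face dimensions is carried along so that appending a piece keeps them
strictly increasing. -/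
lemma GradReach.exists_isRealization (h1 : 0 ≤ r₁) (h2 : 0 ≤ r₂) {θ₀ : ℝ} (hθ : θ₀ < 0)
    {v : Fin 3 → ℝ} {C : ℝ} (h : GradReach r₁ r₂ v C) :
    ∃ x y z T, IsRealization θ₀ r₁ r₂ v C x y z T ∧
      ∃ n τ, HasPieces z T n τ ∧ ∃ K : Fin n → Finset (Fin 3),
        (∀ i, ∀ t ∈ Icc (τ i.castSucc) (τ i.succ), z t ∈ face (K i)) ∧
        (∀ i, z (τ i.succ) ∈ faceInterior (K i)) ∧ (∀ i, 0 < faceDim (K i)) ∧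
        (StrictMono fun i => faceDim (K i)) ∧ ∀ i, faceDim (K i) ≤ faceDim (zeroSet v) := by
  induction h with
  | zero =>
    refine ⟨_, _, _, _, isRealization_zero θ₀ r₁ r₂, 0, fun _ => 0,
      ⟨fun i j hij => absurd hij (by lia), rfl, rfl, fun i => i.elim0⟩, fun i => i.elim0,
      fun i => i.elim0, fun i => i.elim0, fun i => i.elim0, fun i => i.elim0, fun i => i.elim0⟩
  | @step p v y C _ hv hy hs hsub hne ih =>
    obtain ⟨x, η, z, T, hr, n, τ, ⟨hmono, h0, hT, haff⟩, K, hface, hint, hpos, hK, hle⟩ := ih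
    have hs' : ∀ i, y i = 0 ∨ p i = 0 ∧ v i = 0 := fun i => (hs i).imp_right fun h => ⟨hsub i h, h⟩
    have hu : v - p - rotR r₁ r₂ *ᵥ y ≠ 0 := fun hu => by
      obtain ⟨i, hi, hvi⟩ := hne
      rw [eq_of_increment_eq_zero h1 h2 hy hs' hu] at hvi
      exact hvi hi
    obtain ⟨x', y', z', T', hr', hTT', hzz, hab⟩ := hr.exists_extend hθ hv hy hs' hu
    have hzT : z' T = p := by rw [hzz T le_rfl, hr.z_eq T le_rfl]
    have hτT : ∀ k, τ k ≤ T := fun k => hT ▸ hmono.monotone (Fin.le_last k)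
    have hτ0 : ∀ k, 0 ≤ τ k := fun k => h0 ▸ hmono.monotone (Fin.zero_le k)
    have hdim : faceDim (zeroSet p) < faceDim (zeroSet v) := by
      have hlt : (zeroSet v).card < (zeroSet p).card := by
        refine Finset.card_lt_card ⟨fun i hi => ?_, fun hc => ?_⟩
        · rw [mem_zeroSet] at hi ⊢; exact hsub i hi
        · obtain ⟨i, hi, hvi⟩ := hne
          exact hvi (mem_zeroSet.1 (hc (mem_zeroSet.2 hi)))
      -- `faceDim` uses truncated subtraction, so the strict inequality needs `card ≤ 3`.
      have := Finset.card_le_univ (zeroSet p)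
      simp only [Fintype.card_fin] at this
      simp only [faceDim]; omega
    have hnewface : ∀ t ∈ Icc T T', z' t ∈ face (zeroSet v) := by
      intro t ht
      refine ⟨hr'.reg.z_nonneg t (hr.time_nonneg.trans ht.1), fun i hi => ?_⟩
      rw [mem_zeroSet] at hi
      obtain ⟨a, b, hab⟩ := hab
      have e0 := congrFun (hab T ⟨le_rfl, hTT'.le⟩) i
      have e1 := congrFun (hab T' ⟨hTT'.le, le_rfl⟩) i
      rw [hzT, hsub i hi] at e0
      rw [hr'.z_eq T' le_rfl, hi] at e1
      rw [hab t ht]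
      simp only [Pi.add_apply, Pi.smul_apply, smul_eq_mul] at e0 e1 ⊢
      have hb : (T' - T) * b i = 0 := by linarith
      have hb' : b i = 0 := (mul_eq_zero.1 hb).resolve_left (by linarith)
      rw [hb'] at e0 ⊢
      linarith
    refine ⟨x', y', z', T', hr', n + 1, Fin.snoc (α := fun _ => ℝ) τ T', ⟨?_, ?_, ?_, ?_⟩,
      Fin.snoc (α := fun _ => Finset (Fin 3)) K (zeroSet v), ?_, ?_, ?_, ?_, ?_⟩
    · rw [Fin.strictMono_iff_lt_succ]
      intro i
      induction i using Fin.lastCases with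
      | last => rw [Fin.succ_last, Fin.snoc_last, Fin.snoc_castSucc, hT]; exact hTT'
      | cast i =>
        rw [Fin.succ_castSucc, Fin.snoc_castSucc, Fin.snoc_castSucc]
        exact hmono i.castSucc_lt_succ
    · rw [← Fin.castSucc_zero, Fin.snoc_castSucc, h0]
    · rw [Fin.snoc_last]
    · intro i
      induction i using Fin.lastCases with
      | last => rw [Fin.succ_last, Fin.snoc_last, Fin.snoc_castSucc, hT]; exact hab
      | cast i =>
        rw [Fin.succ_castSucc, Fin.snoc_castSucc, Fin.snoc_castSucc]
        obtain ⟨a, b, h⟩ := haff i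
        exact ⟨a, b, fun t ht => by rw [hzz t (ht.2.trans (hτT _)), h t ht]⟩
    · intro i
      induction i using Fin.lastCases with
      | last =>
        rw [Fin.succ_last, Fin.snoc_last, Fin.snoc_castSucc, Fin.snoc_last, hT]; exact hnewface
      | cast i =>
        rw [Fin.succ_castSucc, Fin.snoc_castSucc, Fin.snoc_castSucc, Fin.snoc_castSucc]
        intro t ht
        rw [hzz t (ht.2.trans (hτT _))]
        exact hface i t ht
    · intro i
      induction i using Fin.lastCases with
      | last =>
        rw [Fin.succ_last, Fin.snoc_last, Fin.snoc_last, hr'.z_eq T' le_rfl]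
        exact ⟨fun i hi => mem_zeroSet.1 hi,
          fun i hi => (hv i).lt_of_ne' fun h => hi (mem_zeroSet.2 h)⟩
      | cast i =>
        rw [Fin.succ_castSucc, Fin.snoc_castSucc, Fin.snoc_castSucc, hzz _ (hτT _)]
        exact hint i
    · intro i
      induction i using Fin.lastCases with
      | last => rw [Fin.snoc_last]; omega
      | cast i => rw [Fin.snoc_castSucc]; exact hpos i
    · intro i j hij
      induction j using Fin.lastCases with
      | last =>
        induction i using Fin.lastCases with
        | last => exact absurd hij (lt_irrefl _)
        | cast i =>
          simp only [Fin.snoc_castSucc, Fin.snoc_last]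
          exact (hle i).trans_lt hdim
      | cast j =>
        induction i using Fin.lastCases with
        | last => exact absurd hij (not_lt.2 (Fin.le_last _))
        | cast i =>
          simp only [Fin.snoc_castSucc]
          exact hK (Fin.castSucc_lt_castSucc_iff.1 hij)
    · intro i
      induction i using Fin.lastCases with
      | last => rw [Fin.snoc_last]
      | cast i => rw [Fin.snoc_castSucc]; exact (hle i).trans hdim.le

/-! ### The main theorem -/

lemma vpValue_le_of_reach (h1 : 0 ≤ r₁) (h2 : 0 ≤ r₂) {θ₀ : ℝ} (hθ : θ₀ < 0)
    {v : Fin 3 → ℝ} {C : ℝ} (h : Reach r₁ r₂ v C) :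
    vpValue (rotDrift θ₀) 1 (rotR r₁ r₂) v ≤ -θ₀ * C := by
  obtain ⟨x, y, z, T, hr⟩ := h.exists_isRealization h1 h2 hθ
  -- The infimum of a real set is meaningful only with a lower bound; costs are nonnegative.
  refine csInf_le ⟨0, ?_⟩ ⟨x, y, z, T, hr.isFeasible, hr.cost.symm⟩
  rintro c ⟨x, y, z, T, hf, rfl⟩
  exact mul_nonneg (by norm_num)
    (intervalIntegral.integral_nonneg hf.1 fun _ _ => gammaNormSq_one_nonneg _)

end

theorem mainTheorem4 (θ₀ r₁ r₂ : ℝ) (hθ₀ : θ₀ < 0) (hr₁ : 0 ≤ r₁) (hr₂ : 0 ≤ r₂)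
    (hC : ReflectionCondition r₁ r₂) (v : Fin 3 → ℝ) (hv : ∀ i, 0 ≤ v i)
    (hfin : ∃ x y z T, IsOptimalTriple (rotDrift θ₀) 1 (rotR r₁ r₂) v x y z T ∧
      HasFinitelyManyPieces z T) :
    ∃ x y z T, IsOptimalTriple (rotDrift θ₀) 1 (rotR r₁ r₂) v x y z T ∧ IsGradual z T := by
  obtain ⟨x, y, z, T, ⟨⟨-, hx, hreg, hzT⟩, hopt⟩, n, τ, hpieces⟩ := hfin
  obtain ⟨C, hreach, hle⟩ := exists_reach_of_hasPieces (θ₀ := θ₀) hx hreg hpieces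
  rw [hzT] at hreach
  rw [hopt] at hle
  obtain ⟨⟨-, -, h12, -, hsum⟩, hcond⟩ := hC
  -- The extracted chain is optimal: `-θ₀ * C ≤ I(v) ≤ -θ₀ * C'` for every chain to `v` of cost
  -- `C'`.
  have hgrad := hreach.gradReach_of_optimal hr₂ h12 hsum hcond fun C' h' =>
    le_of_mul_le_mul_left (hle.trans (vpValue_le_of_reach hr₁ hr₂ hθ₀ h')) (neg_pos.2 hθ₀)
  obtain ⟨x', y', z', T', hr, n', τ', hp, K, hface, hint, hpos, hK, -⟩ :=
    hgrad.exists_isRealization hr₁ hr₂ hθ₀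
  exact ⟨x', y', z', T', ⟨hr.isFeasible, hr.cost.trans
    (le_antisymm hle (vpValue_le_of_reach hr₁ hr₂ hθ₀ hreach))⟩, n', τ', hp, K, hface, hint,
    hpos, hK⟩
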